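/- Throughout, C*-algebras are complex and not necessarily unital. For C*-algebras $A,B$ with algebraic tensor product $A\odot B$ over $\mathbb C$, a C*-seminorm on $A\odot B$ is a submultiplicative seminorm $N$ with $N(t^*t)=N(t)^2$. The algebra $A\otimes_{\max}B$ is the completion of $A\odot B$ for the supremum of all C*-seminorms, and $A\otimes_{\min}B$ is its completion for the spatial norm $\|t\|_{\min}=\sup_{\pi_1,\pi_2}\|(\pi_1\odot\pi_2)(t)\|$, where $\pi_1,\pi_2$ run over the representations of $A$ and $B$ on Hilbert spaces $H$ and $K$, and $\pi_1\odot\pi_2$ acts on the Hilbert space $H\otimes K$. A semilattice is a partially ordered set $L$ in which any two elements $\ell,\ell'$ have a greatest lower bound $\ell\wedge\ell'$. A C*-algebra $A$ is $L$-graded by a family $(A_\ell)_{\ell\in L}$ of C*-subalgebras (closed *-subalgebras) if the family $(A_\ell)$ is linearly independent, the linear span of $\bigcup_\ell A_\ell$ is dense in $A$, and $A_\ell A_{\ell'}\subset A_{\ell\wedge\ell'}$ for all $\ell,\ell'\in L$. Let $L$ and $M$ be semilattices, let $A$ be a C*-algebra $L$-graded by $(A_\ell)_{\ell\in L}$, let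 $B$ be a C*-algebra $M$-graded by $(B_m)_{m\in M}$, and let $\alpha\in\{\min,\max\}$. Equip $L\times M$ with the product order. Then: 1. For all $\ell\in L$, $m\in M$, the canonical *-homomorphism $A_\ell\otimes_\alpha B_m\to A\otimes_\alpha B$ induced by the inclusions is injective, so that $A_\ell\otimes_\alpha B_m$ is identified with a C*-subalgebra of $A\otimes_\alpha B$; and $A\otimes_\alpha B$ is $(L\times M)$-graded by the family $(A_\ell\otimes_\alpha B_m)_{(\ell,m)\in L\times M}$. 2. In particular, for every C*-algebra $C$, the canonical *-homomorphisms $A_\ell\otimes_\alpha C\to A\otimes_\alpha C$ are injective, and $A\otimes_\alpha C$ is $L$-graded by the family $(A_\ell\otimes_\alpha C)_{\ell\in L}$. -/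

import Mathlib

open scoped TensorProduct
open UniformSpace (Completion)

noncomputable section

/-- A C*-seminorm on a (possibly non-unital) complex *-algebra. -/
structure CStarSeminorm (R : Type*) [NonUnitalRing R] [StarRing R] [Module ℂ R]
    extends Seminorm ℂ R where
  mul_le' : ∀ x y : R, toFun (x * y) ≤ toFun x * toFun y
  star_mul_self' : ∀ x : R, toFun (star x * x) = toFun x ^ 2

namespace CStarSeminorm

section Basic

variable {R : Type*} [NonUnitalRing R] [StarRing R] [Module ℂ R]

instance : CoeFun (CStarSeminorm R) (fun _ => R → ℝ) := ⟨fun p => p.toSeminorm⟩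

variable (p : CStarSeminorm R)

theorem mul_le (x y : R) : p (x * y) ≤ p x * p y := p.mul_le' x y

theorem star_mul_self (x : R) : p (star x * x) = p x ^ 2 := p.star_mul_self' x

theorem nonneg (x : R) : 0 ≤ p x := apply_nonneg p.toSeminorm x

theorem le_star (x : R) : p x ≤ p (star x) := by
  rcases (p.nonneg x).eq_or_lt with h | h
  · rw [← h]; exact p.nonneg _
  · have h1 := p.mul_le (star x) x
    rw [p.star_mul_self, sq] at h1
    exact le_of_mul_le_mul_right h1 h

theorem apply_star (x : R) : p (star x) = p x :=
  le_antisymm (by simpa using p.le_star (star x)) (p.le_star x)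

end Basic

/-- The norm of the image under a *-homomorphism to a C*-algebra is a C*-seminorm. -/
def ofHom {R D : Type*} [NonUnitalRing R] [StarRing R] [Module ℂ R] [NonUnitalCStarAlgebra D]
    (f : R →⋆ₙₐ[ℂ] D) : CStarSeminorm R where
  toFun x := ‖f x‖
  map_zero' := by simp
  add_le' x y := by simpa using norm_add_le (f x) (f y)
  neg' x := by simp
  smul' c x := by simp [map_smul, norm_smul]
  mul_le' x y := by simpa using norm_mul_le (f x) (f y)
  star_mul_self' x := by simp [map_star, CStarRing.norm_star_mul_self, sq]

@[simp]
theorem ofHom_apply {R D : Type*} [NonUnitalRing R] [StarRing R] [Module ℂ R]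
    [NonUnitalCStarAlgebra D] (f : R →⋆ₙₐ[ℂ] D) (x : R) : ofHom f x = ‖f x‖ := rfl

/-- The pullback of a C*-seminorm along a *-homomorphism. -/
def comap {R S : Type*} [NonUnitalRing R] [StarRing R] [Module ℂ R] [NonUnitalRing S] [StarRing S]
    [Module ℂ S] (p : CStarSeminorm S) (f : R →⋆ₙₐ[ℂ] S) : CStarSeminorm R where
  toFun x := p (f x)
  map_zero' := by simp
  add_le' x y := by simpa using map_add_le_add p.toSeminorm (f x) (f y)
  neg' x := by simp
  smul' c x := by simp [map_smul, map_smul_eq_mul]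
  mul_le' x y := by simpa using p.mul_le (f x) (f y)
  star_mul_self' x := by simpa [map_star] using p.star_mul_self (f x)

@[simp]
theorem comap_apply {R S : Type*} [NonUnitalRing R] [StarRing R] [Module ℂ R] [NonUnitalRing S]
    [StarRing S] [Module ℂ S] (p : CStarSeminorm S) (f : R →⋆ₙₐ[ℂ] S) (x : R) :
    p.comap f x = p (f x) := rfl

section Pre

variable {R : Type*} [NonUnitalRing R] [StarRing R] [Module ℂ R]

/-- A copy of `R`, carrying the C*-seminorm `p` as its norm. -/
@[nolint unusedArguments]
def Pre (_p : CStarSeminorm R) : Type _ := R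

variable (p : CStarSeminorm R)

instance : NonUnitalRing p.Pre := inferInstanceAs (NonUnitalRing R)
instance : StarRing p.Pre := inferInstanceAs (StarRing R)
instance : Module ℂ p.Pre := inferInstanceAs (Module ℂ R)
instance [IsScalarTower ℂ R R] : IsScalarTower ℂ p.Pre p.Pre :=
  inferInstanceAs (IsScalarTower ℂ R R)
instance [SMulCommClass ℂ R R] : SMulCommClass ℂ p.Pre p.Pre :=
  inferInstanceAs (SMulCommClass ℂ R R)
instance [StarModule ℂ R] : StarModule ℂ p.Pre := inferInstanceAs (StarModule ℂ R)

instance : SeminormedAddCommGroup p.Pre :=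
  AddGroupSeminorm.toSeminormedAddCommGroup (E := p.Pre) p.toAddGroupSeminorm

/-- The identity map from `R` to its copy with the norm `p`. -/
def toPre : R →⋆ₙₐ[ℂ] p.Pre where
  toFun x := x
  map_smul' _ _ := rfl
  map_zero' := rfl
  map_add' _ _ := rfl
  map_mul' _ _ := rfl
  map_star' _ := rfl

theorem toPre_surjective : Function.Surjective p.toPre := fun x => ⟨x, rfl⟩

theorem norm_toPre (x : R) : ‖p.toPre x‖ = p x := rfl

theorem norm_pre (x : p.Pre) : ‖x‖ = p x := rfl

instance : NonUnitalSeminormedRing p.Pre where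
  __ := (inferInstance : SeminormedAddCommGroup p.Pre)
  __ := (inferInstance : NonUnitalRing p.Pre)
  norm_mul_le x y := p.mul_le x y

instance : NormedSpace ℂ p.Pre where
  norm_smul_le c x := (map_smul_eq_mul p.toSeminorm c x).le

instance : NormedStarGroup p.Pre where
  norm_star_le x := (p.apply_star x).le

end Pre


section Completed

variable {R : Type*} [NonUnitalRing R] [StarRing R] [Module ℂ R]

/-- The (Hausdorff) completion of `R` with respect to the C*-seminorm `p`. -/
def Completed (p : CStarSeminorm R) : Type _ := Completion p.Pre

variable (p : CStarSeminorm R)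

instance : NormedAddCommGroup p.Completed := inferInstanceAs (NormedAddCommGroup (Completion p.Pre))
instance : NormedSpace ℂ p.Completed := inferInstanceAs (NormedSpace ℂ (Completion p.Pre))
instance : CompleteSpace p.Completed := inferInstanceAs (CompleteSpace (Completion p.Pre))

/-- The canonical map to the completion, as a linear map. -/
def mkₗ : R →ₗ[ℂ] p.Completed where
  toFun x := ((p.toPre x : p.Pre) : Completion p.Pre)
  map_add' x y := by rw [map_add]; exact Completion.coe_add _ _
  map_smul' c x := by rw [map_smul]; exact Completion.coe_smul _ _

theorem norm_mkₗ (x : R) : ‖p.mkₗ x‖ = p x := Completion.norm_coe (p.toPre x)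

theorem denseRange_mkₗ : DenseRange p.mkₗ := Completion.denseRange_coe (α := p.Pre)

instance : Mul p.Completed where
  mul x y := (Completion.isDenseInducing_coe.prodMap Completion.isDenseInducing_coe).extend
    (fun q : p.Pre × p.Pre => ((q.1 * q.2 : p.Pre) : Completion p.Pre)) (x, y)

theorem mkₗ_mul (x y : R) : p.mkₗ (x * y) = p.mkₗ x * p.mkₗ y :=
  ((Completion.isDenseInducing_coe.prodMap Completion.isDenseInducing_coe).extend_eq
      ((Completion.continuous_coe p.Pre).comp continuous_mul) (p.toPre x, p.toPre y)).symm

theorem continuous_mul_completed : Continuous fun q : p.Completed × p.Completed => q.1 * q.2 := by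
  let m := (AddMonoidHom.mul : p.Pre →+ p.Pre →+ p.Pre).compr₂ Completion.toCompl
  have h : Continuous fun q : p.Pre × p.Pre => m q.1 q.2 :=
    (Completion.continuous_coe p.Pre).comp continuous_mul
  have di : IsDenseInducing (Completion.toCompl : p.Pre → Completion p.Pre) :=
    Completion.isDenseInducing_coe
  exact (di.extend_Z_bilin di h :)

instance : ContinuousMul p.Completed := ⟨p.continuous_mul_completed⟩

instance : Star p.Completed where
  star x := Completion.map (star : p.Pre → p.Pre) x

theorem uniformContinuous_star_pre : UniformContinuous (star : p.Pre → p.Pre) :=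
  star_isometry.uniformContinuous

theorem mkₗ_star (x : R) : p.mkₗ (star x) = star (p.mkₗ x) :=
  (Completion.map_coe p.uniformContinuous_star_pre (p.toPre x)).symm

instance : ContinuousStar p.Completed := ⟨Completion.continuous_map⟩

variable {p} in
@[elab_as_elim]
theorem completed_induction {P : p.Completed → Prop} (x : p.Completed)
    (hc : IsClosed {x | P x}) (h : ∀ x : R, P (p.mkₗ x)) : P x :=
  Completion.induction_on (α := p.Pre) x hc h

variable {p} in
@[elab_as_elim]
theorem completed_induction₂ {P : p.Completed → p.Completed → Prop} (x y : p.Completed)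
    (hc : IsClosed {q : p.Completed × p.Completed | P q.1 q.2})
    (h : ∀ x y : R, P (p.mkₗ x) (p.mkₗ y)) : P x y :=
  Completion.induction_on₂ (α := p.Pre) (β := p.Pre) x y hc h

variable {p} in
@[elab_as_elim]
theorem completed_induction₃ {P : p.Completed → p.Completed → p.Completed → Prop}
    (x y z : p.Completed)
    (hc : IsClosed {q : p.Completed × p.Completed × p.Completed | P q.1 q.2.1 q.2.2})
    (h : ∀ x y z : R, P (p.mkₗ x) (p.mkₗ y) (p.mkₗ z)) : P x y z :=
  Completion.induction_on₃ (α := p.Pre) (β := p.Pre) (γ := p.Pre) x y z hc h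

theorem smul_mul_completed [IsScalarTower ℂ R R] (c : ℂ) (x y : p.Completed) :
    (c • x) * y = c • (x * y) := by
  refine completed_induction₂ x y ?_ fun x y => ?_
  · exact isClosed_eq ((continuous_fst.const_smul c).mul continuous_snd) (continuous_mul.const_smul c)
  · rw [← mkₗ_mul, ← map_smul, ← map_smul, ← mkₗ_mul, smul_mul_assoc]

theorem mul_smul_completed [SMulCommClass ℂ R R] (c : ℂ) (x y : p.Completed) :
    x * (c • y) = c • (x * y) := by
  refine completed_induction₂ x y ?_ fun x y => ?_
  · exact isClosed_eq (continuous_fst.mul (continuous_snd.const_smul c)) (continuous_mul.const_smul c)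
  · rw [← mkₗ_mul, ← map_smul, ← map_smul, ← mkₗ_mul, mul_smul_comm]

theorem star_smul_completed [StarModule ℂ R] (c : ℂ) (x : p.Completed) :
    star (c • x) = star c • star x := by
  refine completed_induction x ?_ fun x => ?_
  · exact isClosed_eq (continuous_const_smul c).star ((continuous_const_smul (star c)).comp continuous_star)
  · rw [← mkₗ_star, ← map_smul, ← map_smul, ← mkₗ_star, star_smul]

instance : NonUnitalNormedRing p.Completed where
  __ := (inferInstance : NormedAddCommGroup p.Completed)
  left_distrib x y z := by
    refine completed_induction₃ x y z ?_ fun x y z => ?_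
    · exact isClosed_eq (by fun_prop) (by fun_prop)
    simp only [← map_add, ← mkₗ_mul, mul_add]
  right_distrib x y z := by
    refine completed_induction₃ x y z ?_ fun x y z => ?_
    · exact isClosed_eq (by fun_prop) (by fun_prop)
    simp only [← map_add, ← mkₗ_mul, add_mul]
  zero_mul x := by
    refine completed_induction x ?_ fun x => ?_
    · exact isClosed_eq (by fun_prop) (by fun_prop)
    rw [← map_zero p.mkₗ, ← mkₗ_mul, zero_mul]
  mul_zero x := by
    refine completed_induction x ?_ fun x => ?_
    · exact isClosed_eq (by fun_prop) (by fun_prop)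
    rw [← map_zero p.mkₗ, ← mkₗ_mul, mul_zero]
  mul_assoc x y z := by
    refine completed_induction₃ x y z ?_ fun x y z => ?_
    · exact isClosed_eq (by fun_prop) (by fun_prop)
    simp only [← mkₗ_mul, mul_assoc]
  norm_mul_le x y := by
    refine completed_induction₂ x y ?_ fun x y => ?_
    · exact isClosed_le (by fun_prop) (by fun_prop)
    simpa only [← mkₗ_mul, norm_mkₗ] using p.mul_le x y

instance : StarRing p.Completed where
  star_involutive x := by
    refine completed_induction x ?_ fun x => ?_
    · exact isClosed_eq (by fun_prop) (by fun_prop)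
    simp only [← mkₗ_star, star_star]
  star_mul x y := by
    refine completed_induction₂ x y ?_ fun x y => ?_
    · exact isClosed_eq (by fun_prop) (by fun_prop)
    simp only [← mkₗ_star, ← mkₗ_mul, star_mul]
  star_add x y := by
    refine completed_induction₂ x y ?_ fun x y => ?_
    · exact isClosed_eq (by fun_prop) (by fun_prop)
    simp only [← mkₗ_star, ← map_add, star_add]

instance : CStarRing p.Completed where
  norm_mul_self_le x := by
    refine completed_induction x ?_ fun x => ?_
    · exact isClosed_le (by fun_prop) (by fun_prop)
    rw [← mkₗ_star, ← mkₗ_mul, norm_mkₗ, norm_mkₗ, p.star_mul_self, sq]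

/-- The completion with respect to a C*-seminorm is a C*-algebra. -/
instance [IsScalarTower ℂ R R] [SMulCommClass ℂ R R] [StarModule ℂ R] :
    NonUnitalCStarAlgebra p.Completed where
  smul_assoc c x y := p.smul_mul_completed c x y
  smul_comm c x y := (p.mul_smul_completed c x y).symm
  star_smul c x := p.star_smul_completed c x

/-- The canonical *-homomorphism to the completion. -/
def toCompleted : R →⋆ₙₐ[ℂ] p.Completed where
  toFun := p.mkₗ
  map_smul' c x := map_smul p.mkₗ c x
  map_zero' := map_zero p.mkₗ
  map_add' := map_add p.mkₗ
  map_mul' := p.mkₗ_mul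
  map_star' := p.mkₗ_star

theorem norm_toCompleted (x : R) : ‖p.toCompleted x‖ = p x := p.norm_mkₗ x

theorem denseRange_toCompleted : DenseRange p.toCompleted := p.denseRange_mkₗ

/-- A *-homomorphism that does not increase the C*-seminorms extends to the completions. -/
def mapCompleted {S : Type*} [NonUnitalRing S] [StarRing S] [Module ℂ S] (q : CStarSeminorm S)
    (f : R →⋆ₙₐ[ℂ] S) (hf : ∀ x, q (f x) ≤ p x) : p.Completed →⋆ₙₐ[ℂ] q.Completed :=
  let g : p.Pre →L[ℂ] q.Pre :=
    LinearMap.mkContinuous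
      { toFun := fun x => q.toPre (f x), map_add' := map_add f, map_smul' := map_smul f } 1
      (fun x => by rw [one_mul]; exact hf x)
  let F : p.Completed →L[ℂ] q.Completed := g.completion
  have hF : ∀ x : R, F (p.mkₗ x) = q.mkₗ (f x) := fun x => g.completion_apply_coe (p.toPre x)
  { toFun := F
    map_smul' := map_smul F
    map_zero' := map_zero F
    map_add' := map_add F
    map_mul' := fun x y => by
      refine completed_induction₂ x y ?_ fun x y => ?_
      · exact isClosed_eq (by fun_prop) (by fun_prop)
      simp only [← mkₗ_mul, hF, map_mul]
    map_star' := fun x => by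
      refine completed_induction x ?_ fun x => ?_
      · exact isClosed_eq (by fun_prop) (by fun_prop)
      simp only [← mkₗ_star, hF, map_star] }

theorem mapCompleted_toCompleted {S : Type*} [NonUnitalRing S] [StarRing S] [Module ℂ S]
    (q : CStarSeminorm S) (f : R →⋆ₙₐ[ℂ] S) (hf : ∀ x, q (f x) ≤ p x) (x : R) :
    p.mapCompleted q f hf (p.toCompleted x) = q.toCompleted (f x) :=
  ContinuousLinearMap.completion_apply_coe (α := p.Pre) (β := q.Pre) _ (p.toPre x)

end Completed



section Bound

theorem exists_selfAdjoint_quasi_sqrt {A : Type*} [NonUnitalCStarAlgebra A] (a : A)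
    (ha : ‖a‖ ≤ 1) : ∃ d : A, star d = d ∧ d + d - d * d = star a * a := by
  let _ := CStarAlgebra.spectralOrder A
  have _ := CStarAlgebra.spectralOrderedRing A
  have hsa : IsSelfAdjoint (star a * a) := IsSelfAdjoint.star_mul_self a
  set f : ℝ → ℝ := fun x => 1 - √(1 - x) with hf
  have hf0 : f 0 = 0 := by simp [hf]
  have hfc : Continuous f := by fun_prop
  refine ⟨cfcₙ f (star a * a), ?_, ?_⟩
  · exact (cfcₙ_predicate f (star a * a) : IsSelfAdjoint _).star_eq
  · rw [← cfcₙ_add f f (star a * a), ← cfcₙ_mul f f (star a * a), ← cfcₙ_sub _ _ (star a * a)]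
    conv_rhs => rw [← cfcₙ_id' ℝ (star a * a)]
    refine cfcₙ_congr fun x hx => ?_
    have hx1 : x ≤ 1 := by
      have h1 : ‖x‖ ≤ ‖star a * a‖ := by
        simpa [cfcₙ_id' ℝ (star a * a)] using
          norm_apply_le_norm_cfcₙ (fun x : ℝ => x) (star a * a) hx
      rw [CStarRing.norm_star_mul_self] at h1
      have h2 : x ≤ ‖x‖ := Real.le_norm_self x
      nlinarith [norm_nonneg a]
    have := Real.mul_self_sqrt (show 0 ≤ 1 - x by linarith)
    simp only [hf]
    nlinarith

/-- A C*-algebra acting on `R` by left multipliers acts contractively for every C*-seminorm. -/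
theorem multiplier_le {A R : Type*} [NonUnitalCStarAlgebra A] [NonUnitalRing R] [StarRing R]
    [Module ℂ R] [IsScalarTower ℂ R R] [SMulCommClass ℂ R R] [StarModule ℂ R]
    (p : CStarSeminorm R) (T : A →ₗ[ℂ] R →ₗ[ℂ] R) (hmul : ∀ a b s, T (a * b) s = T a (T b s))
    (hadj : ∀ a s t, star (T a s) * t = star s * T (star a) t) (a : A) (s : R) :
    p (T a s) ≤ ‖a‖ * p s := by
  have key : ∀ a : A, ‖a‖ ≤ 1 → p (T a s) ≤ p s := by
    intro a ha
    obtain ⟨d, hd, hda⟩ := exists_selfAdjoint_quasi_sqrt a ha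
    have hsum : star (T a s) * T a s + star (s - T d s) * (s - T d s) = star s * s := by
      have h1 : star (T a s) * T a s = star s * (T d s + T d s - T d (T d s)) := by
        rw [hadj, ← hmul, ← hda, map_sub, map_add, LinearMap.sub_apply, LinearMap.add_apply, hmul]
      rw [h1, star_sub, sub_mul, hadj, hd]
      simp only [mul_sub, mul_add, map_sub]
      abel
    let _ := CStarAlgebra.spectralOrder p.Completed
    have _ := CStarAlgebra.spectralOrderedRing p.Completed
    have h2 : ‖star (p.toCompleted (T a s)) * p.toCompleted (T a s)‖ ≤
        ‖star (p.toCompleted s) * p.toCompleted s‖ := by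
      refine CStarAlgebra.norm_le_norm_of_nonneg_of_le (star_mul_self_nonneg _) ?_
      have := congrArg p.toCompleted hsum
      simp only [map_add, map_mul, map_star] at this
      rw [← this]
      exact le_add_of_nonneg_right (star_mul_self_nonneg _)
    rw [CStarRing.norm_star_mul_self, CStarRing.norm_star_mul_self, norm_toCompleted,
      norm_toCompleted] at h2
    exact le_of_sq_le_sq (by simpa [sq] using h2) (p.nonneg s)
  rcases eq_or_ne a 0 with rfl | h
  · simp
  · have hn : ‖a‖ ≠ 0 := norm_ne_zero_iff.mpr h
    have h3 := key (((‖a‖ : ℂ))⁻¹ • a) (by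
      rw [norm_smul, norm_inv, Complex.norm_real, norm_norm, inv_mul_cancel₀ hn])
    rw [map_smul, LinearMap.smul_apply, map_smul_eq_mul, norm_inv, Complex.norm_real, norm_norm,
      inv_mul_le_iff₀ (norm_pos_iff.mpr h)] at h3
    exact h3

variable {A B : Type*} [NonUnitalCStarAlgebra A] [NonUnitalCStarAlgebra B]

theorem tmul_le (p : CStarSeminorm (A ⊗[ℂ] B)) (a : A) (b : B) : p (a ⊗ₜ[ℂ] b) ≤ ‖a‖ * ‖b‖ := by
  have hl : ∀ (a : A) (s : A ⊗[ℂ] B), p (LinearMap.rTensorHom B (LinearMap.mul ℂ A a) s) ≤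
      ‖a‖ * p s := by
    refine p.multiplier_le ((LinearMap.rTensorHom B).comp (LinearMap.mul ℂ A)) ?_ ?_
    · intro a b s
      induction s with
      | zero => simp
      | tmul x y => simp [mul_assoc]
      | add x y hx hy => simp only [map_add, hx, hy]
    · intro a s t
      induction s with
      | zero => simp
      | add x y hx hy => simp only [map_add, star_add, add_mul, hx, hy]
      | tmul x y =>
        induction t with
        | zero => simp
        | add x y hx hy => simp only [map_add, mul_add, hx, hy]
        | tmul z w => simp [mul_assoc]
  have hr : ∀ (b : B) (s : A ⊗[ℂ] B), p (LinearMap.lTensorHom A (LinearMap.mul ℂ B b) s) ≤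
      ‖b‖ * p s := by
    refine p.multiplier_le ((LinearMap.lTensorHom A).comp (LinearMap.mul ℂ B)) ?_ ?_
    · intro a b s
      induction s with
      | zero => simp
      | tmul x y => simp [mul_assoc]
      | add x y hx hy => simp only [map_add, hx, hy]
    · intro a s t
      induction s with
      | zero => simp
      | add x y hx hy => simp only [map_add, star_add, add_mul, hx, hy]
      | tmul x y =>
        induction t with
        | zero => simp
        | add x y hx hy => simp only [map_add, mul_add, hx, hy]
        | tmul z w => simp [mul_assoc]
  have h1 : p (a ⊗ₜ[ℂ] b) ^ 2 ≤ (‖a‖ * ‖b‖) * p (a ⊗ₜ[ℂ] b) := by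
    have h2 := hl (star a) (LinearMap.lTensorHom A (LinearMap.mul ℂ B (star b)) (a ⊗ₜ[ℂ] b))
    have h3 := hr (star b) (a ⊗ₜ[ℂ] b)
    rw [← p.star_mul_self]
    simp only [LinearMap.coe_lTensorHom, LinearMap.coe_rTensorHom, LinearMap.lTensor_tmul,
      LinearMap.rTensor_tmul, LinearMap.mul_apply', norm_star, TensorProduct.star_tmul,
      Algebra.TensorProduct.tmul_mul_tmul] at h2 h3 ⊢
    rw [mul_assoc]
    exact h2.trans (mul_le_mul_of_nonneg_left h3 (norm_nonneg a))
  rcases (p.nonneg (a ⊗ₜ[ℂ] b)).eq_or_lt with h | h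
  · rw [← h]; positivity
  · rw [sq] at h1
    exact le_of_mul_le_mul_right h1 h

theorem exists_bound (t : A ⊗[ℂ] B) : ∃ M : ℝ, ∀ p : CStarSeminorm (A ⊗[ℂ] B), p t ≤ M := by
  induction t with
  | zero => exact ⟨0, fun p => by simp⟩
  | tmul a b => exact ⟨‖a‖ * ‖b‖, fun p => p.tmul_le a b⟩
  | add x y hx hy =>
    obtain ⟨M, hM⟩ := hx
    obtain ⟨N, hN⟩ := hy
    exact ⟨M + N, fun p => (map_add_le_add p.toSeminorm x y).trans (add_le_add (hM p) (hN p))⟩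

end Bound

section Sup

open scoped Pointwise

variable {A B : Type*} [NonUnitalCStarAlgebra A] [NonUnitalCStarAlgebra B]

theorem bddAbove_values (S : Set (CStarSeminorm (A ⊗[ℂ] B))) (t : A ⊗[ℂ] B) :
    BddAbove ((fun p : CStarSeminorm (A ⊗[ℂ] B) => p t) '' S) := by
  obtain ⟨M, hM⟩ := exists_bound t
  exact ⟨M, by rintro _ ⟨p, -, rfl⟩; exact hM p⟩

/-- The pointwise supremum of a set of C*-seminorms on the algebraic tensor product of two
C*-algebras. -/
def sup (S : Set (CStarSeminorm (A ⊗[ℂ] B))) : CStarSeminorm (A ⊗[ℂ] B) :=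
  have hle : ∀ t, ∀ p ∈ S, p t ≤ sSup ((fun p : CStarSeminorm (A ⊗[ℂ] B) => p t) '' S) :=
    fun t p hp => le_csSup (bddAbove_values S t) ⟨p, hp, rfl⟩
  have hnn : ∀ t, 0 ≤ sSup ((fun p : CStarSeminorm (A ⊗[ℂ] B) => p t) '' S) := fun t =>
    Real.sSup_nonneg (by rintro _ ⟨p, -, rfl⟩; exact p.nonneg t)
  have hsup : ∀ t M, 0 ≤ M → (∀ p ∈ S, p t ≤ M) →
      sSup ((fun p : CStarSeminorm (A ⊗[ℂ] B) => p t) '' S) ≤ M := fun t M hM h =>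
    Real.sSup_le (by rintro _ ⟨p, hp, rfl⟩; exact h p hp) hM
  { Seminorm.of (fun t => sSup ((fun p : CStarSeminorm (A ⊗[ℂ] B) => p t) '' S))
      (fun x y => hsup _ _ (add_nonneg (hnn x) (hnn y)) fun p hp =>
        (map_add_le_add p.toSeminorm x y).trans (add_le_add (hle x p hp) (hle y p hp)))
      (fun c x => by
        have : (fun p : CStarSeminorm (A ⊗[ℂ] B) => p (c • x)) '' S =
            ‖c‖ • ((fun p : CStarSeminorm (A ⊗[ℂ] B) => p x) '' S) := by
          rw [← Set.image_smul, Set.image_image]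
          exact Set.image_congr fun p _ => map_smul_eq_mul p.toSeminorm c x
        rw [this, Real.sSup_smul_of_nonneg (norm_nonneg c), smul_eq_mul]) with
    mul_le' := fun x y => hsup _ _ (mul_nonneg (hnn x) (hnn y)) fun p hp =>
      (p.mul_le x y).trans (mul_le_mul (hle x p hp) (hle y p hp) (p.nonneg y) (hnn x))
    star_mul_self' := fun x => by
      refine le_antisymm (hsup _ _ (sq_nonneg _) fun p hp => ?_) ?_
      · rw [p.star_mul_self]
        exact pow_le_pow_left₀ (p.nonneg x) (hle x p hp) 2
      · refine (Real.le_sqrt (hnn _) (hnn _)).mp (hsup _ _ (Real.sqrt_nonneg _) fun p hp => ?_)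
        exact Real.le_sqrt_of_sq_le ((p.star_mul_self x).symm.le.trans (hle _ p hp)) }

theorem sup_apply (S : Set (CStarSeminorm (A ⊗[ℂ] B))) (t : A ⊗[ℂ] B) :
    sup S t = sSup ((fun p : CStarSeminorm (A ⊗[ℂ] B) => p t) '' S) := rfl

theorem le_sup {S : Set (CStarSeminorm (A ⊗[ℂ] B))} {p : CStarSeminorm (A ⊗[ℂ] B)} (hp : p ∈ S)
    (t : A ⊗[ℂ] B) : p t ≤ sup S t :=
  le_csSup (bddAbove_values S t) ⟨p, hp, rfl⟩

theorem sup_le {S : Set (CStarSeminorm (A ⊗[ℂ] B))} {t : A ⊗[ℂ] B} {M : ℝ} (hM : 0 ≤ M)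
    (h : ∀ p ∈ S, p t ≤ M) : sup S t ≤ M :=
  Real.sSup_le (by rintro _ ⟨p, hp, rfl⟩; exact h p hp) hM

end Sup

end CStarSeminorm

/-- The Hilbert tensor product of two Hilbert spaces. -/
abbrev HilbertTensor (H K : Type*) [NormedAddCommGroup H] [InnerProductSpace ℂ H]
    [NormedAddCommGroup K] [InnerProductSpace ℂ K] : Type _ :=
  Completion (H ⊗[ℂ] K)

namespace HilbertTensor

variable {H K : Type*} [NormedAddCommGroup H] [InnerProductSpace ℂ H]
  [NormedAddCommGroup K] [InnerProductSpace ℂ K]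

/-- The elementary tensor `h ⊗ k` in the Hilbert tensor product. -/
def tmul (h : H) (k : K) : HilbertTensor H K := ((h ⊗ₜ[ℂ] k : H ⊗[ℂ] K) : Completion (H ⊗[ℂ] K))

theorem clm_ext {F G : HilbertTensor H K →L[ℂ] HilbertTensor H K}
    (h : ∀ (x : H) (y : K), F (tmul x y) = G (tmul x y)) : F = G := by
  ext z
  induction z using Completion.induction_on with
  | hp => exact isClosed_eq F.continuous G.continuous
  | ih z =>
    induction z with
    | zero => rw [Completion.coe_zero, map_zero, map_zero]
    | tmul x y => exact h x y
    | add x y hx hy => rw [Completion.coe_add, map_add, map_add, hx, hy]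

/-- The operator `S ⊗ T` on the Hilbert tensor product. -/
def op (S : H →L[ℂ] H) (T : K →L[ℂ] K) : HilbertTensor H K →L[ℂ] HilbertTensor H K :=
  (TensorProduct.mapL S T).completion

@[simp]
theorem op_tmul (S : H →L[ℂ] H) (T : K →L[ℂ] K) (x : H) (y : K) :
    op S T (tmul x y) = tmul (S x) (T y) :=
  (TensorProduct.mapL S T).completion_apply_coe (x ⊗ₜ[ℂ] y)

theorem tmul_add (x : H) (y z : K) : tmul x (y + z) = tmul x y + tmul x z := by
  simp only [tmul, TensorProduct.tmul_add, Completion.coe_add]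

theorem add_tmul (x y : H) (z : K) : tmul (x + y) z = tmul x z + tmul y z := by
  simp only [tmul, TensorProduct.add_tmul, Completion.coe_add]

theorem smul_tmul (c : ℂ) (x : H) (y : K) : tmul (c • x) y = c • tmul x y := by
  simp only [tmul, ← TensorProduct.smul_tmul', Completion.coe_smul]

theorem tmul_smul (c : ℂ) (x : H) (y : K) : tmul x (c • y) = c • tmul x y := by
  simp only [tmul, TensorProduct.tmul_smul, Completion.coe_smul]

theorem op_add_left (S S' : H →L[ℂ] H) (T : K →L[ℂ] K) : op (S + S') T = op S T + op S' T :=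
  clm_ext fun _ _ => by simp [add_tmul]

theorem op_add_right (S : H →L[ℂ] H) (T T' : K →L[ℂ] K) : op S (T + T') = op S T + op S T' :=
  clm_ext fun _ _ => by simp [tmul_add]

theorem op_smul_left (c : ℂ) (S : H →L[ℂ] H) (T : K →L[ℂ] K) : op (c • S) T = c • op S T :=
  clm_ext fun _ _ => by simp [smul_tmul]

theorem op_smul_right (c : ℂ) (S : H →L[ℂ] H) (T : K →L[ℂ] K) : op S (c • T) = c • op S T :=
  clm_ext fun _ _ => by simp [tmul_smul]

theorem op_mul (S S' : H →L[ℂ] H) (T T' : K →L[ℂ] K) :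
    op (S * S') (T * T') = op S T * op S' T' :=
  clm_ext fun _ _ => by simp

theorem op_star [CompleteSpace H] [CompleteSpace K] (S : H →L[ℂ] H) (T : K →L[ℂ] K) :
    op (star S) (star T) = star (op S T) := by
  refine (ContinuousLinearMap.eq_adjoint_iff _ _).mpr fun z w => ?_
  induction z, w using Completion.induction_on₂ with
  | hp => exact isClosed_eq (by fun_prop) (by fun_prop)
  | ih z w =>
    induction z with
    | zero => rw [Completion.coe_zero, map_zero, inner_zero_left, inner_zero_left]
    | add x y hx hy => simp only [Completion.coe_add, map_add, inner_add_left, hx, hy]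
    | tmul x y =>
      induction w with
      | zero => rw [Completion.coe_zero, map_zero, inner_zero_right, inner_zero_right]
      | add x y hx hy => simp only [Completion.coe_add, map_add, inner_add_right, hx, hy]
      | tmul x' y' =>
        have h1 := op_tmul (star S) (star T) x y
        have h2 := op_tmul S T x' y'
        simp only [tmul] at h1 h2
        rw [h1, h2, Completion.inner_coe, Completion.inner_coe, TensorProduct.inner_tmul,
          TensorProduct.inner_tmul, ContinuousLinearMap.star_eq_adjoint,
          ContinuousLinearMap.star_eq_adjoint, ContinuousLinearMap.adjoint_inner_left,
          ContinuousLinearMap.adjoint_inner_left]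

end HilbertTensor

namespace CStarTensor

section Hom

variable {A B : Type*} [NonUnitalCStarAlgebra A] [NonUnitalCStarAlgebra B]

/-- A linear map on the algebraic tensor product which is multiplicative and *-preserving on
elementary tensors is a *-homomorphism. -/
def homOfTmul {D : Type*} [NonUnitalRing D] [StarRing D] [Module ℂ D] (f : A ⊗[ℂ] B →ₗ[ℂ] D)
    (hmul : ∀ a a' b b', f ((a * a') ⊗ₜ[ℂ] (b * b')) = f (a ⊗ₜ[ℂ] b) * f (a' ⊗ₜ[ℂ] b'))
    (hstar : ∀ a b, f (star a ⊗ₜ[ℂ] star b) = star (f (a ⊗ₜ[ℂ] b))) : A ⊗[ℂ] B →⋆ₙₐ[ℂ] D where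
  toFun := f
  map_smul' := map_smul f
  map_zero' := map_zero f
  map_add' := map_add f
  map_mul' x y := by
    induction x with
    | zero => simp
    | add x x' hx hx' => simp only [add_mul, map_add, hx, hx']
    | tmul a b =>
      induction y with
      | zero => simp
      | add y y' hy hy' => simp only [mul_add, map_add, hy, hy']
      | tmul a' b' => rw [Algebra.TensorProduct.tmul_mul_tmul, hmul]
  map_star' x := by
    induction x with
    | zero => simp
    | add x x' hx hx' => simp only [star_add, map_add, hx, hx']
    | tmul a b => rw [TensorProduct.star_tmul, hstar]

variable {H K : Type*} [NormedAddCommGroup H] [InnerProductSpace ℂ H] [CompleteSpace H]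
  [NormedAddCommGroup K] [InnerProductSpace ℂ K] [CompleteSpace K]

/-- The linear map `a ⊗ b ↦ π a ⊗ ρ b`. -/
def repₗ (π : A →⋆ₙₐ[ℂ] (H →L[ℂ] H)) (ρ : B →⋆ₙₐ[ℂ] (K →L[ℂ] K)) :
    A ⊗[ℂ] B →ₗ[ℂ] (HilbertTensor H K →L[ℂ] HilbertTensor H K) :=
  TensorProduct.lift (LinearMap.mk₂ ℂ (fun a b => HilbertTensor.op (π a) (ρ b))
    (fun a a' b => by rw [map_add, HilbertTensor.op_add_left])
    (fun c a b => by rw [map_smul, HilbertTensor.op_smul_left])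
    (fun a b b' => by rw [map_add, HilbertTensor.op_add_right])
    (fun c a b => by rw [map_smul, HilbertTensor.op_smul_right]))

theorem repₗ_tmul (π : A →⋆ₙₐ[ℂ] (H →L[ℂ] H)) (ρ : B →⋆ₙₐ[ℂ] (K →L[ℂ] K)) (a : A) (b : B) :
    repₗ π ρ (a ⊗ₜ[ℂ] b) = HilbertTensor.op (π a) (ρ b) := rfl

/-- The representation `π ⊙ ρ` of the algebraic tensor product on the Hilbert tensor product, given
by `(π ⊙ ρ) (a ⊗ b) = π a ⊗ ρ b`. -/
def rep (π : A →⋆ₙₐ[ℂ] (H →L[ℂ] H)) (ρ : B →⋆ₙₐ[ℂ] (K →L[ℂ] K)) :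
    A ⊗[ℂ] B →⋆ₙₐ[ℂ] (HilbertTensor H K →L[ℂ] HilbertTensor H K) :=
  homOfTmul (repₗ π ρ)
    (fun a a' b b' => by
      rw [repₗ_tmul, repₗ_tmul, repₗ_tmul, map_mul, map_mul, HilbertTensor.op_mul])
    (fun a b => by rw [repₗ_tmul, repₗ_tmul, map_star, map_star, HilbertTensor.op_star])

theorem rep_tmul (π : A →⋆ₙₐ[ℂ] (H →L[ℂ] H)) (ρ : B →⋆ₙₐ[ℂ] (K →L[ℂ] K)) (a : A) (b : B) :
    rep π ρ (a ⊗ₜ[ℂ] b) = HilbertTensor.op (π a) (ρ b) := rfl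

/-- The C*-seminorm `t ↦ ‖(π ⊙ ρ) t‖`. -/
def spatialSeminorm (π : A →⋆ₙₐ[ℂ] (H →L[ℂ] H)) (ρ : B →⋆ₙₐ[ℂ] (K →L[ℂ] K)) :
    CStarSeminorm (A ⊗[ℂ] B) :=
  CStarSeminorm.ofHom (D := HilbertTensor H K →L[ℂ] HilbertTensor H K) (rep π ρ)

theorem spatialSeminorm_apply (π : A →⋆ₙₐ[ℂ] (H →L[ℂ] H)) (ρ : B →⋆ₙₐ[ℂ] (K →L[ℂ] K))
    (t : A ⊗[ℂ] B) : spatialSeminorm π ρ t = ‖rep π ρ t‖ := rfl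

variable {A₁ B₁ : Type*} [NonUnitalCStarAlgebra A₁] [NonUnitalCStarAlgebra B₁]

/-- The *-homomorphism `φ ⊙ ψ` of algebraic tensor products. -/
def algMap (φ : A₁ →⋆ₙₐ[ℂ] A) (ψ : B₁ →⋆ₙₐ[ℂ] B) : A₁ ⊗[ℂ] B₁ →⋆ₙₐ[ℂ] A ⊗[ℂ] B :=
  homOfTmul (TensorProduct.map (φ : A₁ →ₗ[ℂ] A) (ψ : B₁ →ₗ[ℂ] B))
    (fun _ _ _ _ => by simp) (fun _ _ => by simp [map_star])

@[simp]
theorem algMap_tmul (φ : A₁ →⋆ₙₐ[ℂ] A) (ψ : B₁ →⋆ₙₐ[ℂ] B) (a : A₁) (b : B₁) :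
    algMap φ ψ (a ⊗ₜ[ℂ] b) = φ a ⊗ₜ[ℂ] ψ b := rfl

end Hom

universe u v

/-- The two extreme C*-norms on an algebraic tensor product of C*-algebras. -/
inductive Kind
  | min
  | max

section Norms

variable (A : Type u) (B : Type v) [NonUnitalCStarAlgebra A] [NonUnitalCStarAlgebra B]

/-- The maximal C*-norm on the algebraic tensor product: the supremum of all C*-seminorms. -/
def maxNorm : CStarSeminorm (A ⊗[ℂ] B) := CStarSeminorm.sup Set.univ

/-- The C*-seminorms `t ↦ ‖(π ⊙ ρ) t‖`, for representations `π` of `A` and `ρ` of `B` on Hilbert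
spaces. (The universal representation of a C*-algebra, which is faithful, acts on a Hilbert space in
the universe of the algebra, so the universes chosen here impose no restriction.) -/
def spatialSeminorms : Set (CStarSeminorm (A ⊗[ℂ] B)) :=
  {p | ∃ (H : Type u) (_ : NormedAddCommGroup H) (_ : InnerProductSpace ℂ H) (_ : CompleteSpace H)
    (K : Type v) (_ : NormedAddCommGroup K) (_ : InnerProductSpace ℂ K) (_ : CompleteSpace K)
    (π : A →⋆ₙₐ[ℂ] (H →L[ℂ] H)) (ρ : B →⋆ₙₐ[ℂ] (K →L[ℂ] K)),
    p = spatialSeminorm π ρ}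

/-- The minimal (spatial) C*-norm on the algebraic tensor product: the supremum of `‖(π ⊙ ρ) t‖`
over all pairs of representations, which is attained at every pair of faithful ones. -/
def minNorm : CStarSeminorm (A ⊗[ℂ] B) := CStarSeminorm.sup (spatialSeminorms A B)

variable (α : Kind)

/-- The minimal or the maximal C*-norm on the algebraic tensor product. -/
def norm : CStarSeminorm (A ⊗[ℂ] B) :=
  match α with
  | .min => minNorm A B
  | .max => maxNorm A B

end Norms

section Map

variable {A A₁ : Type u} {B B₁ : Type v} [NonUnitalCStarAlgebra A] [NonUnitalCStarAlgebra A₁]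
  [NonUnitalCStarAlgebra B] [NonUnitalCStarAlgebra B₁]

theorem rep_algMap {H K : Type*} [NormedAddCommGroup H] [InnerProductSpace ℂ H] [CompleteSpace H]
    [NormedAddCommGroup K] [InnerProductSpace ℂ K] [CompleteSpace K]
    (π : A →⋆ₙₐ[ℂ] (H →L[ℂ] H)) (ρ : B →⋆ₙₐ[ℂ] (K →L[ℂ] K)) (φ : A₁ →⋆ₙₐ[ℂ] A)
    (ψ : B₁ →⋆ₙₐ[ℂ] B) (t : A₁ ⊗[ℂ] B₁) :
    rep π ρ (algMap φ ψ t) = rep (π.comp φ) (ρ.comp ψ) t := by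
  induction t with
  | zero => rw [map_zero, map_zero, map_zero]
  | tmul a b => rfl
  | add x y hx hy => rw [map_add, map_add, map_add, hx, hy]

theorem norm_algMap_le (α : Kind) (φ : A₁ →⋆ₙₐ[ℂ] A) (ψ : B₁ →⋆ₙₐ[ℂ] B) (t : A₁ ⊗[ℂ] B₁) :
    norm A B α (algMap φ ψ t) ≤ norm A₁ B₁ α t := by
  cases α with
  | max =>
    refine CStarSeminorm.sup_le ((maxNorm A₁ B₁).nonneg t) fun p _ => ?_
    exact CStarSeminorm.le_sup (Set.mem_univ (p.comap (algMap φ ψ))) t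
  | min =>
    refine CStarSeminorm.sup_le ((minNorm A₁ B₁).nonneg t) ?_
    rintro _ ⟨H, _, _, _, K, _, _, _, π, ρ, rfl⟩
    rw [spatialSeminorm_apply, rep_algMap, ← spatialSeminorm_apply]
    exact CStarSeminorm.le_sup (S := spatialSeminorms A₁ B₁)
      (p := spatialSeminorm (π.comp φ) (ρ.comp ψ))
      ⟨H, _, _, inferInstance, K, _, _, inferInstance, π.comp φ, ρ.comp ψ, rfl⟩ t

end Map

end CStarTensor

/-- The C*-tensor product `A ⊗_α B`, for `α` the minimal or the maximal C*-norm: the completion of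
the algebraic tensor product. -/
abbrev CStarTensorProduct (α : CStarTensor.Kind) (A B : Type*) [NonUnitalCStarAlgebra A]
    [NonUnitalCStarAlgebra B] : Type _ :=
  (CStarTensor.norm A B α).Completed

namespace CStarTensor

universe u v

/-- The elementary tensor `a ⊗ b` in `A ⊗_α B`. -/
def tmul (α : Kind) {A B : Type*} [NonUnitalCStarAlgebra A] [NonUnitalCStarAlgebra B]
    (a : A) (b : B) : CStarTensorProduct α A B :=
  (norm A B α).toCompleted (a ⊗ₜ[ℂ] b)

variable {A A₁ : Type u} {B B₁ : Type v} [NonUnitalCStarAlgebra A] [NonUnitalCStarAlgebra A₁]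
  [NonUnitalCStarAlgebra B] [NonUnitalCStarAlgebra B₁]

/-- The morphism `φ ⊗_α ψ` of C*-algebras. -/
def map (α : Kind) (φ : A₁ →⋆ₙₐ[ℂ] A) (ψ : B₁ →⋆ₙₐ[ℂ] B) :
    CStarTensorProduct α A₁ B₁ →⋆ₙₐ[ℂ] CStarTensorProduct α A B :=
  (norm A₁ B₁ α).mapCompleted (norm A B α) (algMap φ ψ) (norm_algMap_le α φ ψ)

theorem map_tmul (α : Kind) (φ : A₁ →⋆ₙₐ[ℂ] A) (ψ : B₁ →⋆ₙₐ[ℂ] B) (a : A₁) (b : B₁) :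
    map α φ ψ (tmul α a b) = tmul α (φ a) (ψ b) :=
  CStarSeminorm.mapCompleted_toCompleted _ _ _ _ _

end CStarTensor

/-- A family of *-subalgebras `(A_i)`, indexed by a meet-semilattice `L`, is a grading of the
C*-algebra `A` if the `A_i` are C*-subalgebras (closed), are linearly independent and total, and
satisfy `A_i A_j ⊆ A_{i ∧ j}`. -/
structure IsCStarGrading {L : Type*} [SemilatticeInf L] {A : Type*} [NonUnitalCStarAlgebra A]
    (𝒜 : L → NonUnitalStarSubalgebra ℂ A) : Prop where
  isClosed : ∀ i, IsClosed (𝒜 i : Set A)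
  linearIndependent : ∀ (s : Finset L) (x : L → A), (∀ i ∈ s, x i ∈ 𝒜 i) → ∑ i ∈ s, x i = 0 →
    ∀ i ∈ s, x i = 0
  total : Dense (Submodule.span ℂ (⋃ i, (𝒜 i : Set A)) : Set A)
  mul_mem : ∀ i j, ∀ a ∈ 𝒜 i, ∀ b ∈ 𝒜 j, a * b ∈ 𝒜 (i ⊓ j)

end

noncomputable section

namespace CStarGraded

/-! The argument rests on the truncations of a graded C*-algebra. For each `l` there is a
*-homomorphism `P_l : A → A` that is the identity on `𝒜 i` when `l ≤ i` and zero on `𝒜 i` otherwise.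
On the algebraic sum it is multiplicative because `l ≤ i ⊓ j` holds exactly when `l ≤ i` and `l ≤
j`. The real point is contractivity. Over a finite inf-closed set of indices the sum of the
components is closed (`isClosed_sumOver`), and the same holds for the graphs of the truncation. The
graph is then a C*-algebra with injective, hence isometric, first projection. Finite sets have
finite inf-closure, so the estimate holds on the whole algebraic sum and passes to the closure.

Although `𝒜 l` need not be an ideal, `P_l(A) 𝒜 l ⊆ 𝒜 l`. So `A` acts on `𝒜 l` by multipliers,
extending left multiplication, and norms can be compared as for ideals. A C*-seminorm on the tensor
product of two components extends to `A ⊗ B` as the operator norm of the tensored multipliers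
(`exists_seminorm_extension`), which settles the maximal norm. A representation of a component
extends to the whole algebra on the same Hilbert space (`exists_rep_extension`), which settles the
minimal norm. The canonical maps are therefore isometric.

Linear independence of the tensor grading follows by applying `P_l ⊗ P_m` at a maximal index of the
support of a vanishing sum. Density and the product rule come from elementary tensors. Components
enter as ranges of injective *-homomorphisms, so that inclusions of subalgebras and the identity of
`C` are treated alike; the second assertion is the case of a one-point semilattice. -/

open scoped CStarAlgebra in
theorem continuous_starAlgHom {A B : Type*} [NonUnitalCStarAlgebra A] [NonUnitalCStarAlgebra B]
    (φ : A →⋆ₙₐ[ℂ] B) : Continuous φ :=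
  map_continuous φ

/-- The linear span of a set stable under multiplication and star, as a *-subalgebra. -/
def spanStarSubalgebra {A : Type*} [NonUnitalCStarAlgebra A] (G : Set A)
    (hmul : ∀ x ∈ G, ∀ y ∈ G, x * y ∈ G) (hstar : ∀ x ∈ G, star x ∈ G) :
    NonUnitalStarSubalgebra ℂ A where
  toSubmodule := Submodule.span ℂ G
  mul_mem' {a b} ha hb := by
    change a * b ∈ Submodule.span ℂ G
    induction ha, hb using Submodule.span_induction₂ with
    | mem_mem x y hx hy => exact Submodule.subset_span (hmul x hx y hy)
    | zero_left y hy => rw [zero_mul]; exact zero_mem _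
    | zero_right x hx => rw [mul_zero]; exact zero_mem _
    | add_left x y z hx hy hz h1 h2 => rw [add_mul]; exact add_mem h1 h2
    | add_right x y z hx hy hz h1 h2 => rw [mul_add]; exact add_mem h1 h2
    | smul_left r x y hx hy h => rw [smul_mul_assoc]; exact Submodule.smul_mem _ _ h
    | smul_right r x y hx hy h => rw [mul_smul_comm]; exact Submodule.smul_mem _ _ h
  star_mem' {a} ha := by
    change star a ∈ Submodule.span ℂ G
    induction ha using Submodule.span_induction with
    | mem x hx => exact Submodule.subset_span (hstar x hx)
    | zero => rw [star_zero]; exact zero_mem _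
    | add x y hx hy h1 h2 => rw [star_add]; exact add_mem h1 h2
    | smul r x hx h => rw [star_smul]; exact Submodule.smul_mem _ _ h

/-! ### Closedness of finite sums of components. -/

section Closed

variable {A : Type*} [NonUnitalCStarAlgebra A]

/-- Pairs congruent modulo `I` with second component in `D`, where `D` normalizes `I`. -/
def congruentPairs (I D : NonUnitalStarSubalgebra ℂ A)
    (hDI : ∀ x ∈ D, ∀ y ∈ I, x * y ∈ I) : NonUnitalStarSubalgebra ℂ (A × A) where
  carrier := {e | e.2 ∈ D ∧ e.1 - e.2 ∈ I}
  zero_mem' := ⟨zero_mem D, by simp⟩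
  add_mem' {a b} ha hb := ⟨add_mem ha.1 hb.1, by
    have := add_mem ha.2 hb.2
    rwa [sub_add_sub_comm] at this⟩
  smul_mem' c a ha := ⟨SMulMemClass.smul_mem c ha.1, by
    have := SMulMemClass.smul_mem c ha.2
    rwa [smul_sub] at this⟩
  star_mem' {a} ha := ⟨star_mem ha.1, by
    have := star_mem ha.2
    rwa [star_sub] at this⟩
  mul_mem' {a b} ha hb := ⟨mul_mem ha.1 hb.1, by
    -- Taking adjoints turns `D I ⊆ I` into `I D ⊆ I`. The claim is then read off from `a₁b₁ - a₂b₂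
    -- = (a₁ - a₂)(b₁ - b₂) + a₂(b₁ - b₂) + (a₁ - a₂)b₂`.
    have hID : (a.1 - a.2) * b.2 ∈ I := by
      have := star_mem (hDI _ (star_mem hb.1) _ (star_mem ha.2))
      rwa [star_mul, star_star, star_star] at this
    have := add_mem (add_mem (mul_mem ha.2 hb.2) (hDI _ ha.1 _ hb.2)) hID
    convert this using 1
    simp only [Prod.fst_mul, Prod.snd_mul]
    noncomm_ring⟩

theorem isClosed_congruentPairs {I D : NonUnitalStarSubalgebra ℂ A}
    (hI : IsClosed (I : Set A)) (hD : IsClosed (D : Set A))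
    (hDI : ∀ x ∈ D, ∀ y ∈ I, x * y ∈ I) :
    IsClosed (congruentPairs I D hDI : Set (A × A)) :=
  (hD.preimage continuous_snd).inter (hI.preimage (continuous_fst.sub continuous_snd))

/-- The first projection, restricted to a *-subalgebra of a product. -/
abbrev fstOn {B : Type*} [NonUnitalCStarAlgebra B] (E : NonUnitalStarSubalgebra ℂ (A × B)) :
    E →⋆ₙₐ[ℂ] A :=
  (NonUnitalStarAlgHom.fst ℂ A B).comp (NonUnitalStarSubalgebraClass.subtype E)

/-- The second projection, restricted to a *-subalgebra of a product. -/
abbrev sndOn {B : Type*} [NonUnitalCStarAlgebra B] (E : NonUnitalStarSubalgebra ℂ (A × B)) :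
    E →⋆ₙₐ[ℂ] B :=
  (NonUnitalStarAlgHom.snd ℂ A B).comp (NonUnitalStarSubalgebraClass.subtype E)

/-- The sum `D + I` is the image of the C*-algebra of pairs `(x, d)` under the first projection.
This projection is injective because `D ∩ I = 0`, and an injective *-homomorphism of C*-algebras is
isometric, so its range is closed. -/
theorem isClosed_add {I D : NonUnitalStarSubalgebra ℂ A}
    (hI : IsClosed (I : Set A)) (hD : IsClosed (D : Set A))
    (hDI : ∀ x ∈ D, ∀ y ∈ I, x * y ∈ I) (hdisj : ∀ x ∈ D, x ∈ I → x = 0) :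
    IsClosed {x : A | ∃ d ∈ D, x - d ∈ I} := by
  have hE := isClosed_congruentPairs hI hD hDI
  have hinj : Function.Injective (fstOn (congruentPairs I D hDI)) := by
    rw [injective_iff_map_eq_zero]
    rintro ⟨⟨a, b⟩, hb, hab⟩ (h : a = 0)
    subst h
    have : b = 0 := hdisj b hb (by simpa using hab)
    subst this
    rfl
  have := (NonUnitalStarAlgHom.isometry _ hinj).isClosedEmbedding.isClosed_range
  convert this using 1
  ext x
  constructor
  · rintro ⟨d, hd, hx⟩
    exact ⟨⟨(x, d), hd, hx⟩, rfl⟩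
  · rintro ⟨⟨⟨a, b⟩, hb, hab⟩, rfl⟩
    exact ⟨b, hb, hab⟩

variable {L : Type*}

theorem exists_sum_of_mem_span {𝒜 : L → NonUnitalStarSubalgebra ℂ A} {F : Finset L} {x : A}
    (hx : x ∈ Submodule.span ℂ (⋃ i ∈ F, (𝒜 i : Set A))) :
    ∃ y : L → A, (∀ i, y i ∈ 𝒜 i) ∧ x = ∑ i ∈ F, y i := by
  rw [Submodule.span_iUnion₂] at hx
  have h : ∀ i, Submodule.span ℂ (𝒜 i : Set A) = (𝒜 i).toSubmodule := fun i =>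
    Submodule.span_eq (𝒜 i).toSubmodule
  simp only [h] at hx
  obtain ⟨μ, hμ⟩ := (Submodule.mem_iSup_finset_iff_exists_sum _ _).mp hx
  exact ⟨fun i => μ i, fun i => (μ i).2, hμ.symm⟩

theorem sum_mem_span {𝒜 : L → NonUnitalStarSubalgebra ℂ A} {F s : Finset L} (hs : s ⊆ F)
    {y : L → A} (hy : ∀ i ∈ s, y i ∈ 𝒜 i) :
    ∑ i ∈ s, y i ∈ Submodule.span ℂ (⋃ i ∈ F, (𝒜 i : Set A)) :=
  Submodule.sum_mem _ fun i hi =>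
    Submodule.subset_span (Set.mem_iUnion₂.mpr ⟨i, hs hi, hy i hi⟩)

variable [SemilatticeInf L] {𝒜 : L → NonUnitalStarSubalgebra ℂ A}

/-- The algebraic sum of the components of a graded algebra with indices in `U`. -/
def sumOver (𝒜 : L → NonUnitalStarSubalgebra ℂ A)
    (hmul : ∀ i j, ∀ a ∈ 𝒜 i, ∀ b ∈ 𝒜 j, a * b ∈ 𝒜 (i ⊓ j)) (U : Set L) (hU : InfClosed U) :
    NonUnitalStarSubalgebra ℂ A :=
  spanStarSubalgebra (⋃ i ∈ U, (𝒜 i : Set A))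
    (fun x hx y hy => by
      obtain ⟨i, hi, hx⟩ := Set.mem_iUnion₂.mp hx
      obtain ⟨j, hj, hy⟩ := Set.mem_iUnion₂.mp hy
      exact Set.mem_iUnion₂.mpr ⟨i ⊓ j, hU hi hj, hmul i j x hx y hy⟩)
    (fun x hx => by
      obtain ⟨i, hi, hx⟩ := Set.mem_iUnion₂.mp hx
      exact Set.mem_iUnion₂.mpr ⟨i, hi, star_mem hx⟩)

theorem mem_sumOver {hmul : ∀ i j, ∀ a ∈ 𝒜 i, ∀ b ∈ 𝒜 j, a * b ∈ 𝒜 (i ⊓ j)} {U : Set L}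
    {hU : InfClosed U} {x : A} :
    x ∈ sumOver 𝒜 hmul U hU ↔ x ∈ Submodule.span ℂ (⋃ i ∈ U, (𝒜 i : Set A)) := Iff.rfl

/-- Induction on `F`, splitting off a maximal index `l`. By maximality no meet of elements of
`F.erase l`, and no meet of `l` with one of them, equals `l`. So the remaining indices are
inf-closed, and their sum is stable under multiplication by `𝒜 l`. It meets `𝒜 l` trivially by
independence, and `isClosed_add` applies. -/
theorem isClosed_sumOver (hcl : ∀ i, IsClosed (𝒜 i : Set A))
    (hind : ∀ (s : Finset L) (x : L → A), (∀ i ∈ s, x i ∈ 𝒜 i) → ∑ i ∈ s, x i = 0 →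
      ∀ i ∈ s, x i = 0)
    (hmul : ∀ i j, ∀ a ∈ 𝒜 i, ∀ b ∈ 𝒜 j, a * b ∈ 𝒜 (i ⊓ j)) (F : Finset L)
    (hF : InfClosed (F : Set L)) : IsClosed (sumOver 𝒜 hmul F hF : Set A) := by
  classical
  induction F using Finset.strongInduction with
  | H F ih =>
  rcases F.eq_empty_or_nonempty with rfl | hne
  · have : (sumOver 𝒜 hmul (∅ : Finset L) hF : Set A) = {0} := by
      ext x
      simp [mem_sumOver]
    rw [this]
    exact isClosed_singleton
  obtain ⟨l, hl, hmax⟩ := Finset.exists_maximal hne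
  have hmax' : ∀ i ∈ F, l ≤ i → i = l := fun i hi h => le_antisymm (hmax hi h) h
  have hF' : InfClosed ((F.erase l : Finset L) : Set L) := by
    intro a ha b hb
    simp only [Finset.coe_erase, Set.mem_sdiff, Set.mem_singleton_iff, Finset.mem_coe] at ha hb ⊢
    refine ⟨hF ha.1 hb.1, fun h => ha.2 (hmax' a ha.1 (h ▸ inf_le_left))⟩
  have hI := ih _ (Finset.erase_ssubset hl) hF'
  have hsum : (sumOver 𝒜 hmul F hF : Set A) =
      {x : A | ∃ d ∈ 𝒜 l, x - d ∈ sumOver 𝒜 hmul (F.erase l : Finset L) hF'} := by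
    ext x
    constructor
    · intro hx
      obtain ⟨y, hy, rfl⟩ := exists_sum_of_mem_span (F := F) hx
      refine ⟨y l, hy l, ?_⟩
      rw [← Finset.sum_erase_add F y hl, add_sub_cancel_right]
      exact sum_mem_span (F := F.erase l) subset_rfl fun i _ => hy i
    · rintro ⟨d, hd, hx⟩
      have h1 : d ∈ sumOver 𝒜 hmul F hF :=
        Submodule.subset_span (Set.mem_iUnion₂.mpr ⟨l, hl, hd⟩)
      have h2 : x - d ∈ sumOver 𝒜 hmul F hF :=
        Submodule.span_mono (Set.biUnion_subset_biUnion_left (Finset.erase_subset l F)) hx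
      simpa using add_mem h2 h1
  rw [hsum]
  refine isClosed_add hI (hcl l) ?_ ?_
  · intro x hx y hy
    obtain ⟨z, hz, rfl⟩ := exists_sum_of_mem_span (F := F.erase l) hy
    rw [Finset.mul_sum]
    refine sum_mem fun i hi => Submodule.subset_span (Set.mem_iUnion₂.mpr ⟨l ⊓ i, ?_,
      hmul l i x hx _ (hz i)⟩)
    rw [Finset.mem_erase] at hi
    exact Finset.mem_coe.mpr (Finset.mem_erase.mpr
      ⟨fun h => hi.1 (hmax' i hi.2 (inf_eq_left.mp h)), hF hl hi.2⟩)
  · intro x hx hxI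
    obtain ⟨y, hy, hxy⟩ := exists_sum_of_mem_span (F := F.erase l) hxI
    -- The equality of `x` with the sum of the other `y i` is rewritten as a vanishing sum over `F`
    -- whose `l`-term is `-x`.
    have := hind F (Function.update y l (-x)) (fun i _ => by
      rcases eq_or_ne i l with rfl | h
      · rw [Function.update_self]; exact neg_mem hx
      · rw [Function.update_of_ne h]; exact hy i) (by
      rw [← Finset.sum_erase_add F _ hl, Function.update_self,
        Finset.sum_congr rfl fun i hi => Function.update_of_ne (Finset.ne_of_mem_erase hi) _ _,
        ← hxy, add_neg_cancel]) l hl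
    rw [Function.update_self] at this
    exact neg_eq_zero.mp this

end Closed

/-! ### The truncation *-homomorphisms. -/

section Projection

variable {L A : Type*} [SemilatticeInf L] [NonUnitalCStarAlgebra A]

open scoped Classical in
/-- The graph, over the component of index `i`, of the projection onto the components of index
at least `l`. -/
def truncationGraph (𝒜 : L → NonUnitalStarSubalgebra ℂ A) (l i : L) :
    NonUnitalStarSubalgebra ℂ (A × A) where
  carrier := {e | e.1 ∈ 𝒜 i ∧ e.2 = if l ≤ i then e.1 else 0}
  zero_mem' := ⟨zero_mem _, by simp⟩
  add_mem' {a b} ha hb := ⟨add_mem ha.1 hb.1, by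
    simp only [Prod.fst_add, Prod.snd_add, ha.2, hb.2]; split_ifs <;> simp⟩
  smul_mem' c a ha := ⟨SMulMemClass.smul_mem c ha.1, by
    simp only [Prod.smul_fst, Prod.smul_snd, ha.2]; split_ifs <;> simp⟩
  star_mem' {a} ha := ⟨star_mem ha.1, by
    simp only [Prod.fst_star, Prod.snd_star, ha.2]; split_ifs <;> simp⟩
  mul_mem' {a b} ha hb := ⟨mul_mem ha.1 hb.1, by
    simp only [Prod.fst_mul, Prod.snd_mul, ha.2, hb.2]; split_ifs <;> simp⟩

variable {𝒜 : L → NonUnitalStarSubalgebra ℂ A}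

theorem isClosed_truncationGraph (h𝒜 : IsCStarGrading 𝒜) (l i : L) :
    IsClosed (truncationGraph 𝒜 l i : Set (A × A)) := by
  refine ((h𝒜.isClosed i).preimage continuous_fst).inter (isClosed_eq continuous_snd ?_)
  by_cases h : l ≤ i
  · simpa only [h, if_true] using continuous_fst
  · simpa only [h, if_false] using continuous_const

/-- Second coordinates are determined by first ones, so it is enough that the first coordinate of
the sum vanishes. This strong form yields both the independence of the graphs and the injectivity of
the first projection on their sums. -/
theorem truncationGraph_linearIndependent (h𝒜 : IsCStarGrading 𝒜) (l : L) (s : Finset L)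
    (x : L → A × A) (hx : ∀ i ∈ s, x i ∈ truncationGraph 𝒜 l i)
    (h0 : (∑ i ∈ s, x i).1 = 0) : ∀ i ∈ s, x i = 0 := by
  intro i hi
  rw [Prod.fst_sum] at h0
  have h1 := h𝒜.linearIndependent s (fun i => (x i).1) (fun i hi => (hx i hi).1) h0 i hi
  refine Prod.ext h1 ?_
  rw [(hx i hi).2]
  split_ifs
  · exact h1
  · rfl

/-- The indices above `l` form a filter: `l ≤ i ⊓ j` if and only if `l ≤ i` and `l ≤ j`. This is
what makes truncation multiplicative. -/
theorem truncationGraph_mul_mem (h𝒜 : IsCStarGrading 𝒜) (l i j : L) :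
    ∀ a ∈ truncationGraph 𝒜 l i, ∀ b ∈ truncationGraph 𝒜 l j,
      a * b ∈ truncationGraph 𝒜 l (i ⊓ j) := by
  intro a ha b hb
  refine ⟨h𝒜.mul_mem i j _ ha.1 _ hb.1, ?_⟩
  simp only [Prod.fst_mul, Prod.snd_mul, ha.2, hb.2, le_inf_iff]
  split_ifs <;> simp_all

/-- The finite sum of graphs is closed, hence a C*-algebra, and its injective first projection
preserves norms. Since `A × A` has the supremum norm, the second coordinate is bounded by the first.
-/
theorem norm_snd_le_of_mem_sumOver (h𝒜 : IsCStarGrading 𝒜) (l : L) (F : Finset L)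
    (hF : InfClosed (F : Set L)) {e : A × A}
    (he : e ∈ sumOver (truncationGraph 𝒜 l) (truncationGraph_mul_mem h𝒜 l) F hF) :
    ‖e.2‖ ≤ ‖e.1‖ := by
  have hcl := isClosed_sumOver (isClosed_truncationGraph h𝒜 l)
    (fun s x hx h0 => truncationGraph_linearIndependent h𝒜 l s x hx (by rw [h0]; rfl))
    (truncationGraph_mul_mem h𝒜 l) F hF
  have hinj : Function.Injective
      (fstOn (sumOver (truncationGraph 𝒜 l) (truncationGraph_mul_mem h𝒜 l) F hF)) := by
    rw [injective_iff_map_eq_zero]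
    rintro ⟨e, he⟩ (h : e.1 = 0)
    obtain ⟨y, hy, rfl⟩ := exists_sum_of_mem_span (F := F) he
    refine Subtype.ext (Finset.sum_eq_zero ?_)
    exact truncationGraph_linearIndependent h𝒜 l F y (fun i _ => hy i) h
  have h := NonUnitalStarAlgHom.norm_map _ hinj ⟨e, he⟩
  exact (norm_snd_le e).trans (h.symm.le : ‖e‖ ≤ ‖e.1‖)

theorem infClosed_univ : InfClosed (Set.univ : Set L) := fun _ _ _ _ => trivial

theorem norm_snd_le_of_mem_sumOver_univ (h𝒜 : IsCStarGrading 𝒜) (l : L) {e : A × A}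
    (he : e ∈ sumOver (truncationGraph 𝒜 l) (truncationGraph_mul_mem h𝒜 l) Set.univ
      infClosed_univ) :
    ‖e.2‖ ≤ ‖e.1‖ := by
  classical
  obtain ⟨s, hs⟩ : ∃ s : Finset L,
      e ∈ Submodule.span ℂ (⋃ i ∈ s, (truncationGraph 𝒜 l i : Set (A × A))) := by
    rw [mem_sumOver] at he
    induction he using Submodule.span_induction with
    | mem x hx =>
      obtain ⟨i, -, hi⟩ := Set.mem_iUnion₂.mp hx
      exact ⟨{i}, Submodule.subset_span (by simpa using hi)⟩
    | zero => exact ⟨∅, zero_mem _⟩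
    | add x y _ _ hx hy =>
      obtain ⟨s, hs⟩ := hx
      obtain ⟨t, ht⟩ := hy
      exact ⟨s ∪ t, add_mem
        (Submodule.span_mono (Set.biUnion_subset_biUnion_left Finset.subset_union_left) hs)
        (Submodule.span_mono (Set.biUnion_subset_biUnion_left Finset.subset_union_right) ht)⟩
    | smul c x _ hx =>
      obtain ⟨s, hs⟩ := hx
      exact ⟨s, Submodule.smul_mem _ c hs⟩
  -- Only finitely many indices occur, and closing them under meets adds only finitely many more.
  have hfin : (infClosure (s : Set L)).Finite := s.finite_toSet.infClosure
  refine norm_snd_le_of_mem_sumOver h𝒜 l hfin.toFinset (by simp) ?_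
  refine Submodule.span_mono (Set.biUnion_subset_biUnion_left fun i hi => ?_) hs
  simpa using subset_infClosure hi

/-- The graph of the projection onto the components of index at least `l`. -/
def projectionGraph (h𝒜 : IsCStarGrading 𝒜) (l : L) : NonUnitalStarSubalgebra ℂ (A × A) :=
  (sumOver (truncationGraph 𝒜 l) (truncationGraph_mul_mem h𝒜 l) Set.univ
    infClosed_univ).topologicalClosure

theorem truncationGraph_le_projectionGraph (h𝒜 : IsCStarGrading 𝒜) (l i : L) :
    truncationGraph 𝒜 l i ≤ projectionGraph h𝒜 l := fun _ hx =>
  NonUnitalStarSubalgebra.le_topologicalClosure _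
    (Submodule.subset_span (Set.mem_iUnion₂.mpr ⟨i, trivial, hx⟩))

theorem isClosed_projectionGraph (h𝒜 : IsCStarGrading 𝒜) (l : L) :
    IsClosed (projectionGraph h𝒜 l : Set (A × A)) :=
  NonUnitalStarSubalgebra.isClosed_topologicalClosure _

/-- The norm inequality is a closed condition and so passes to the closure. Injectivity of the first
projection alone need not pass; it is recovered from the inequality. -/
theorem norm_snd_le_of_mem_projectionGraph (h𝒜 : IsCStarGrading 𝒜) (l : L) {e : A × A}
    (he : e ∈ projectionGraph h𝒜 l) : ‖e.2‖ ≤ ‖e.1‖ := by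
  have hcl : IsClosed {e : A × A | ‖e.2‖ ≤ ‖e.1‖} := isClosed_le (by fun_prop) (by fun_prop)
  exact closure_minimal (fun e he => norm_snd_le_of_mem_sumOver_univ h𝒜 l he) hcl he

/-- Injectivity comes from the norm estimate. The range is then closed and contains every component,
so it is everything by totality. -/
theorem bijective_fstOn_projectionGraph (h𝒜 : IsCStarGrading 𝒜) (l : L) :
    Function.Bijective (fstOn (projectionGraph h𝒜 l)) := by
  have hcl := isClosed_projectionGraph h𝒜 l
  have hinj : Function.Injective (fstOn (projectionGraph h𝒜 l)) := by
    rw [injective_iff_map_eq_zero]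
    rintro ⟨e, he⟩ (h : e.1 = 0)
    have := norm_snd_le_of_mem_projectionGraph h𝒜 l he
    rw [h, norm_zero, norm_le_zero_iff] at this
    exact Subtype.ext (Prod.ext h this)
  refine ⟨hinj, ?_⟩
  have hr := (NonUnitalStarAlgHom.isometry _ hinj).isClosedEmbedding.isClosed_range
  rw [← Set.range_eq_univ, ← hr.closure_eq, Set.eq_univ_iff_forall]
  intro x
  refine closure_mono ?_ (h𝒜.total x)
  intro y hy
  change y ∈ NonUnitalStarAlgHom.range (fstOn (projectionGraph h𝒜 l))
  refine (Submodule.span_le (p := (NonUnitalStarAlgHom.range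
    (fstOn (projectionGraph h𝒜 l))).toSubmodule)).mpr ?_ hy
  intro z hz
  obtain ⟨i, hi⟩ := Set.mem_iUnion.mp hz
  classical
  exact ⟨⟨(z, if l ≤ i then z else 0),
    truncationGraph_le_projectionGraph h𝒜 l i ⟨hi, rfl⟩⟩, rfl⟩

/-- The projection of a graded C*-algebra onto the closed sum of its components of index at
least `l`, which is a *-homomorphism. -/
def projection (h𝒜 : IsCStarGrading 𝒜) (l : L) : A →⋆ₙₐ[ℂ] A :=
  (sndOn (projectionGraph h𝒜 l)).comp
    ((StarAlgEquiv.ofBijective _ (bijective_fstOn_projectionGraph h𝒜 l)).symm :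
      A →⋆ₙₐ[ℂ] projectionGraph h𝒜 l)

theorem projection_eq_of_mem_projectionGraph (h𝒜 : IsCStarGrading 𝒜) (l : L) {e : A × A}
    (he : e ∈ projectionGraph h𝒜 l) : projection h𝒜 l e.1 = e.2 := by
  have h : (StarAlgEquiv.ofBijective _ (bijective_fstOn_projectionGraph h𝒜 l)).symm e.1 =
      ⟨e, he⟩ := by
    rw [StarAlgEquiv.symm_apply_eq]; rfl
  change ((StarAlgEquiv.ofBijective _ (bijective_fstOn_projectionGraph h𝒜 l)).symm e.1).1.2 = _
  rw [h]

theorem projection_of_le (h𝒜 : IsCStarGrading 𝒜) {l i : L} (h : l ≤ i) {x : A} (hx : x ∈ 𝒜 i) :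
    projection h𝒜 l x = x :=
  projection_eq_of_mem_projectionGraph h𝒜 l (e := (x, x))
    (truncationGraph_le_projectionGraph h𝒜 l i ⟨hx, by simp [h]⟩)

theorem projection_of_not_le (h𝒜 : IsCStarGrading 𝒜) {l i : L} (h : ¬ l ≤ i) {x : A}
    (hx : x ∈ 𝒜 i) : projection h𝒜 l x = 0 :=
  projection_eq_of_mem_projectionGraph h𝒜 l (e := (x, 0))
    (truncationGraph_le_projectionGraph h𝒜 l i ⟨hx, by simp [h]⟩)

/-- In general `𝒜 i` maps `𝒜 l` only into `𝒜 (i ⊓ l)`. The projection kills the indices not above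
`l`, and for the others `i ⊓ l = l`; density and closedness of `𝒜 l` finish. -/
theorem projection_mul_mem (h𝒜 : IsCStarGrading 𝒜) (l : L) (a : A) {x : A} (hx : x ∈ 𝒜 l) :
    projection h𝒜 l a * x ∈ 𝒜 l := by
  have hc : Continuous (projection h𝒜 l) := continuous_starAlgHom _
  have hcl : IsClosed {a : A | projection h𝒜 l a * x ∈ 𝒜 l} :=
    (h𝒜.isClosed l).preimage (hc.mul continuous_const)
  refine closure_minimal ?_ hcl (h𝒜.total a)
  intro b hb
  induction hb using Submodule.span_induction with
  | mem y hy =>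
    obtain ⟨i, hi⟩ := Set.mem_iUnion.mp hy
    change projection h𝒜 l y * x ∈ 𝒜 l
    by_cases h : l ≤ i
    · rw [projection_of_le h𝒜 h hi]
      simpa [inf_eq_right.mpr h] using h𝒜.mul_mem i l y hi x hx
    · rw [projection_of_not_le h𝒜 h hi, zero_mul]
      exact zero_mem _
  | zero => simp
  | add y z _ _ h1 h2 =>
    change projection h𝒜 l (y + z) * x ∈ 𝒜 l
    rw [map_add, add_mul]
    exact add_mem h1 h2
  | smul c y _ h =>
    change projection h𝒜 l (c • y) * x ∈ 𝒜 l
    rw [map_smul, smul_mul_assoc]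
    exact SMulMemClass.smul_mem c h

end Projection

/-! ### C*-seminorms induced by bounded multipliers. -/

section Seminorm

variable {S R : Type*} [NonUnitalRing S] [Module ℂ S] [NonUnitalRing R] [StarRing R]
  [Module ℂ R] (p : CStarSeminorm R) (Θ : S →ₗ[ℂ] R →ₗ[ℂ] R)
  (hbdd : ∀ t, ∃ C, ∀ s, p (Θ t s) ≤ C * p s)

/-- The bounded operator on a seminormed *-algebra given by a bounded multiplier. -/
def multiplierCLM (t : S) : p.Pre →L[ℂ] p.Pre :=
  LinearMap.mkContinuousOfExistsBound
    { toFun := fun s => p.toPre (Θ t s)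
      map_add' := map_add (Θ t)
      map_smul' := map_smul (Θ t) } (hbdd t)

theorem le_norm_multiplierCLM (t : S) (s : R) :
    p (Θ t s) ≤ ‖multiplierCLM p Θ hbdd t‖ * p s :=
  (multiplierCLM p Θ hbdd t).le_opNorm (p.toPre s)

variable {p Θ hbdd} in
theorem norm_multiplierCLM_le {t : S} {C : ℝ} (hC : 0 ≤ C) (h : ∀ s, p (Θ t s) ≤ C * p s) :
    ‖multiplierCLM p Θ hbdd t‖ ≤ C :=
  (multiplierCLM p Θ hbdd t).opNorm_le_bound hC h

theorem norm_multiplierCLM_mul_le (hmul : ∀ a b s, Θ (a * b) s = Θ a (Θ b s)) (x y : S) :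
    ‖multiplierCLM p Θ hbdd (x * y)‖ ≤
      ‖multiplierCLM p Θ hbdd x‖ * ‖multiplierCLM p Θ hbdd y‖ := by
  refine norm_multiplierCLM_le (by positivity) fun s => ?_
  rw [hmul, mul_assoc]
  exact (le_norm_multiplierCLM p Θ hbdd x _).trans
    (mul_le_mul_of_nonneg_left (le_norm_multiplierCLM p Θ hbdd y s) (norm_nonneg _))

variable [StarRing S]

/-- As for operators on a Hilbert space, with `p (star s * s)` in the role of the inner product: `p
(Θ t s) ^ 2 = p (star s * Θ (star t * t) s)`, which is at most `‖Θ (star t * t)‖ * p s ^ 2`. -/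
theorem multiplier_sq_le (hmul : ∀ a b s, Θ (a * b) s = Θ a (Θ b s))
    (hadj : ∀ a s t, star (Θ a s) * t = star s * Θ (star a) t) (t : S) :
    ‖multiplierCLM p Θ hbdd t‖ ^ 2 ≤ ‖multiplierCLM p Θ hbdd (star t * t)‖ := by
  refine (Real.le_sqrt (norm_nonneg _) (norm_nonneg _)).mp ?_
  refine norm_multiplierCLM_le (Real.sqrt_nonneg _) fun s => ?_
  refine le_of_sq_le_sq ?_ (mul_nonneg (Real.sqrt_nonneg _) (p.nonneg s))
  rw [← p.star_mul_self, hadj, ← hmul, mul_pow, Real.sq_sqrt (norm_nonneg _)]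
  refine (p.mul_le _ _).trans ?_
  rw [p.apply_star]
  have := mul_le_mul_of_nonneg_left (le_norm_multiplierCLM p Θ hbdd (star t * t) s) (p.nonneg s)
  linarith

variable (hmul : ∀ a b s, Θ (a * b) s = Θ a (Θ b s))
  (hadj : ∀ a s t, star (Θ a s) * t = star s * Θ (star a) t)

/-- The C*-seminorm on an algebra acting by bounded multipliers on a C*-seminormed algebra, given
by the operator norm. -/
def multiplierSeminorm : CStarSeminorm S :=
  { Seminorm.ofSMulLE (fun t => ‖multiplierCLM p Θ hbdd t‖)
      (le_antisymm (norm_multiplierCLM_le le_rfl fun s => by simp) (norm_nonneg _))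
      (fun x y => norm_multiplierCLM_le (by positivity) fun s => by
        rw [map_add, LinearMap.add_apply, add_mul]
        exact (map_add_le_add p.toSeminorm _ _).trans
          (add_le_add (le_norm_multiplierCLM p Θ hbdd x s) (le_norm_multiplierCLM p Θ hbdd y s)))
      (fun c x => norm_multiplierCLM_le (by positivity) fun s => by
        rw [map_smul, LinearMap.smul_apply, map_smul_eq_mul, mul_assoc]
        exact mul_le_mul_of_nonneg_left (le_norm_multiplierCLM p Θ hbdd x s) (norm_nonneg _)) with
    mul_le' := norm_multiplierCLM_mul_le p Θ hbdd hmul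
    star_mul_self' := fun x => by
      change ‖multiplierCLM p Θ hbdd (star x * x)‖ = ‖multiplierCLM p Θ hbdd x‖ ^ 2
      -- Cancel one factor in `‖x‖² ≤ ‖x⋆x‖ ≤ ‖x⋆‖‖x‖`.
      have hle : ∀ x, ‖multiplierCLM p Θ hbdd x‖ ≤ ‖multiplierCLM p Θ hbdd (star x)‖ := by
        intro x
        rcases (norm_nonneg (multiplierCLM p Θ hbdd x)).eq_or_lt with h | h
        · rw [← h]; exact norm_nonneg _
        · have h1 := (multiplier_sq_le p Θ hbdd hmul hadj x).trans
            (norm_multiplierCLM_mul_le p Θ hbdd hmul (star x) x)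
          rw [sq] at h1
          exact le_of_mul_le_mul_right h1 h
      refine le_antisymm ?_ (multiplier_sq_le p Θ hbdd hmul hadj x)
      refine (norm_multiplierCLM_mul_le p Θ hbdd hmul (star x) x).trans ?_
      rw [sq]
      refine mul_le_mul_of_nonneg_right ?_ (norm_nonneg _)
      simpa using hle (star x) }

theorem multiplierSeminorm_apply (t : S) :
    multiplierSeminorm p Θ hbdd hmul hadj t = ‖multiplierCLM p Θ hbdd t‖ := rfl

/-- Submultiplicativity gives one inequality; the other comes from testing the operator on `star r`,
since `p (r * star r) = p r ^ 2`. -/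
theorem multiplierSeminorm_eq_of_mul {t : S} {r : R} (h : ∀ s, Θ t s = r * s) :
    multiplierSeminorm p Θ hbdd hmul hadj t = p r := by
  rw [multiplierSeminorm_apply]
  refine le_antisymm (norm_multiplierCLM_le (p.nonneg r) fun s => ?_) ?_
  · rw [h]; exact p.mul_le r s
  · rcases (p.nonneg r).eq_or_lt with h0 | h0
    · rw [← h0]; exact norm_nonneg _
    · have h1 := le_norm_multiplierCLM p Θ hbdd t (star r)
      have h2 := p.star_mul_self (star r)
      rw [star_star, p.apply_star, sq] at h2
      rw [h, h2, p.apply_star] at h1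
      exact le_of_mul_le_mul_right h1 h0

end Seminorm

/-- An action of the C*-algebra `A` on `I` by multipliers, extending along `φ` the action of `I`
on itself by left multiplication. -/
structure MultiplierAction {I A : Type*} [NonUnitalCStarAlgebra I] [NonUnitalCStarAlgebra A]
    (φ : I →⋆ₙₐ[ℂ] A) where
  /-- the action -/
  act : A →ₗ[ℂ] I →ₗ[ℂ] I
  act_mul : ∀ a b x, act (a * b) x = act a (act b x)
  star_act_mul : ∀ a x y, star (act a x) * y = star x * act (star a) y
  act_apply : ∀ x y, act (φ x) y = x * y

/-! ### Multiplier actions and their tensor products. -/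

namespace MultiplierAction

variable {I J A B : Type*} [NonUnitalCStarAlgebra I] [NonUnitalCStarAlgebra J]
  [NonUnitalCStarAlgebra A] [NonUnitalCStarAlgebra B] {φ : I →⋆ₙₐ[ℂ] A} {ψ : J →⋆ₙₐ[ℂ] B}

theorem norm_act_le (T : MultiplierAction φ) (a : A) (x : I) : ‖T.act a x‖ ≤ ‖a‖ * ‖x‖ :=
  (CStarSeminorm.ofHom (NonUnitalStarAlgHom.id ℂ I)).multiplier_le T.act T.act_mul
    T.star_act_mul a x

/-- The adjoint relation lets any left factor `z` absorb the action of `a`, so `z` annihilates the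
difference of the two sides. Taking `z` to be the adjoint of that difference makes it zero. -/
theorem act_mul_right (T : MultiplierAction φ) (a : A) (x y : I) :
    T.act a (x * y) = T.act a x * y := by
  have h : ∀ z : I, z * (T.act a (x * y) - T.act a x * y) = 0 := fun z => by
    have h1 := T.star_act_mul (star a) (star z)
    rw [star_star, star_star] at h1
    rw [mul_sub, ← mul_assoc, ← h1, ← h1, mul_assoc, sub_self]
  have h2 := h (star (T.act a (x * y) - T.act a x * y))
  rwa [CStarRing.star_mul_self_eq_zero_iff, sub_eq_zero] at h2

/-- The action of the algebraic tensor product by multipliers. -/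
def tensorAct (T : MultiplierAction φ) (U : MultiplierAction ψ) :
    A ⊗[ℂ] B →ₗ[ℂ] I ⊗[ℂ] J →ₗ[ℂ] I ⊗[ℂ] J :=
  TensorProduct.map₂ T.act U.act

variable (T : MultiplierAction φ) (U : MultiplierAction ψ)

theorem tensorAct_tmul (a : A) (b : B) (x : I) (y : J) :
    tensorAct T U (a ⊗ₜ[ℂ] b) (x ⊗ₜ[ℂ] y) = T.act a x ⊗ₜ[ℂ] U.act b y := rfl

theorem tensorAct_mul (t u : A ⊗[ℂ] B) (s : I ⊗[ℂ] J) :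
    tensorAct T U (t * u) s = tensorAct T U t (tensorAct T U u s) := by
  induction s with
  | zero => simp
  | add x y hx hy => simp only [map_add, hx, hy]
  | tmul x y =>
    induction t with
    | zero => simp
    | add t t' h h' => simp only [add_mul, map_add, LinearMap.add_apply, h, h']
    | tmul a b =>
      induction u with
      | zero => simp
      | add t t' h h' => simp only [mul_add, map_add, LinearMap.add_apply, h, h']
      | tmul a' b' =>
        simp only [Algebra.TensorProduct.tmul_mul_tmul, tensorAct_tmul, T.act_mul, U.act_mul]

theorem star_tensorAct_mul (t : A ⊗[ℂ] B) (s r : I ⊗[ℂ] J) :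
    star (tensorAct T U t s) * r = star s * tensorAct T U (star t) r := by
  induction s with
  | zero => simp
  | add x y hx hy => simp only [map_add, star_add, add_mul, hx, hy]
  | tmul x y =>
    induction r with
    | zero => simp
    | add x y hx hy => simp only [map_add, mul_add, hx, hy]
    | tmul x' y' =>
      induction t with
      | zero => simp
      | add t t' h h' =>
        simp only [add_mul, mul_add, map_add, LinearMap.add_apply, star_add, h, h']
      | tmul a b =>
        simp only [Algebra.TensorProduct.tmul_mul_tmul, tensorAct_tmul, TensorProduct.star_tmul,
          T.star_act_mul, U.star_act_mul]

theorem tensorAct_algMap (t s : I ⊗[ℂ] J) :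
    tensorAct T U (CStarTensor.algMap φ ψ t) s = t * s := by
  induction t with
  | zero => simp
  | add t t' h h' => simp only [add_mul, map_add, LinearMap.add_apply, h, h']
  | tmul a b =>
    induction s with
    | zero => simp
    | add t t' h h' => simp only [mul_add, map_add, h, h']
    | tmul x y =>
      simp only [CStarTensor.algMap_tmul, tensorAct_tmul, T.act_apply, U.act_apply,
        Algebra.TensorProduct.tmul_mul_tmul]

/-- Each of `T.act a ⊗ 1` and `1 ⊗ U.act b` is a multiplier action of a C*-algebra, bounded by `‖a‖`
and `‖b‖` through `multiplier_le`. An elementary tensor acts as their composite. -/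
theorem tensorAct_bounded (p : CStarSeminorm (I ⊗[ℂ] J)) (t : A ⊗[ℂ] B) :
    ∃ C, ∀ s, p (tensorAct T U t s) ≤ C * p s := by
  have hl : ∀ (a : A) (s : I ⊗[ℂ] J), p (LinearMap.rTensorHom J (T.act a) s) ≤ ‖a‖ * p s := by
    refine p.multiplier_le ((LinearMap.rTensorHom J).comp T.act) ?_ ?_
    · intro a b s
      induction s with
      | zero => simp
      | tmul x y => simp [T.act_mul]
      | add x y hx hy => simp only [map_add, hx, hy]
    · intro a s t
      induction s with
      | zero => simp
      | add x y hx hy => simp only [map_add, star_add, add_mul, hx, hy]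
      | tmul x y =>
        induction t with
        | zero => simp
        | add x y hx hy => simp only [map_add, mul_add, hx, hy]
        | tmul z w => simp [T.star_act_mul]
  have hr : ∀ (b : B) (s : I ⊗[ℂ] J), p (LinearMap.lTensorHom I (U.act b) s) ≤ ‖b‖ * p s := by
    refine p.multiplier_le ((LinearMap.lTensorHom I).comp U.act) ?_ ?_
    · intro a b s
      induction s with
      | zero => simp
      | tmul x y => simp [U.act_mul]
      | add x y hx hy => simp only [map_add, hx, hy]
    · intro a s t
      induction s with
      | zero => simp
      | add x y hx hy => simp only [map_add, star_add, add_mul, hx, hy]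
      | tmul x y =>
        induction t with
        | zero => simp
        | add x y hx hy => simp only [map_add, mul_add, hx, hy]
        | tmul z w => simp [U.star_act_mul]
  induction t with
  | zero => exact ⟨0, fun s => by simp⟩
  | add t u ht hu =>
    obtain ⟨C, hC⟩ := ht
    obtain ⟨D, hD⟩ := hu
    refine ⟨C + D, fun s => ?_⟩
    rw [map_add, LinearMap.add_apply, add_mul]
    exact (map_add_le_add p.toSeminorm _ _).trans (add_le_add (hC s) (hD s))
  | tmul a b =>
    refine ⟨‖a‖ * ‖b‖, fun s => ?_⟩
    have h : tensorAct T U (a ⊗ₜ[ℂ] b) s =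
        LinearMap.rTensorHom J (T.act a) (LinearMap.lTensorHom I (U.act b) s) := by
      induction s with
      | zero => simp
      | add x y hx hy => simp only [map_add, hx, hy]
      | tmul x y => rfl
    rw [h, mul_assoc]
    exact (hl a _).trans (mul_le_mul_of_nonneg_left (hr b s) (norm_nonneg a))

/-- The extension is the operator norm of `A ⊗ B` acting on `I ⊗ J` seminormed by `p`; elements of
`I ⊗ J` act by left multiplication, where this norm is `p` itself. -/
theorem exists_seminorm_extension (T : MultiplierAction φ) (U : MultiplierAction ψ)
    (p : CStarSeminorm (I ⊗[ℂ] J)) :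
    ∃ q : CStarSeminorm (A ⊗[ℂ] B), ∀ t, q (CStarTensor.algMap φ ψ t) = p t :=
  ⟨multiplierSeminorm p (tensorAct T U) (tensorAct_bounded T U p) (tensorAct_mul T U)
    (star_tensorAct_mul T U), fun t =>
    multiplierSeminorm_eq_of_mul _ _ _ _ _ (tensorAct_algMap T U t)⟩

end MultiplierAction

/-! ### Extending representations along a multiplier action. -/

section Representation

open Filter Topology

section Essential

variable {I H : Type*} [NonUnitalCStarAlgebra I] [NormedAddCommGroup H] [InnerProductSpace ℂ H]
  [CompleteSpace H]

theorem inner_rep_left (π : I →⋆ₙₐ[ℂ] (H →L[ℂ] H)) (x : I) (h k : H) :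
    inner ℂ (π x h) k = inner ℂ h (π (star x) k) := by
  rw [map_star, ContinuousLinearMap.star_eq_adjoint, ContinuousLinearMap.adjoint_inner_right]

/-- A closed linear property of vectors holds everywhere if it holds on the range of a
representation and on its null space. -/
theorem rep_induction (π : I →⋆ₙₐ[ℂ] (H →L[ℂ] H)) {P : H → Prop} (hcl : IsClosed {ξ | P ξ})
    (hadd : ∀ ξ η, P ξ → P η → P (ξ + η)) (hsmul : ∀ (c : ℂ) ξ, P ξ → P (c • ξ))
    (hrange : ∀ x h, P (π x h)) (hnull : ∀ ξ, (∀ x, π x ξ = 0) → P ξ) (ξ : H) : P ξ := by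
  let V : Submodule ℂ H :=
    { carrier := {ξ | P ξ}
      add_mem' := fun {a b} ha hb => hadd a b ha hb
      zero_mem' := hnull 0 fun x => map_zero _
      smul_mem' := hsmul }
  have hV : IsClosed (V : Set H) := hcl
  have : CompleteSpace V := hV.completeSpace_coe
  -- A vector `η` orthogonal to `V` is orthogonal to the range of `π`, hence killed by every `π x`.
  -- It therefore lies in `V` as well, so it is orthogonal to itself.
  have hbot : Vᗮ = ⊥ := by
    rw [Submodule.eq_bot_iff]
    intro η hη
    have h1 : P η := hnull η fun x => by
      rw [← inner_self_eq_zero (𝕜 := ℂ), inner_rep_left]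
      exact (Submodule.mem_orthogonal' V η).mp hη _ (hrange _ _)
    exact inner_self_eq_zero.mp ((Submodule.mem_orthogonal' V η).mp hη η h1)
  have htop : V = ⊤ := (Submodule.orthogonal_eq_bot_iff).mp hbot
  have : ξ ∈ V := htop ▸ Submodule.mem_top
  exact this

theorem exists_approximateUnit (I : Type*) [NonUnitalCStarAlgebra I] :
    ∃ l : Filter I, l.NeBot ∧ (∀ᶠ e in l, ‖e‖ ≤ 1) ∧ ∀ x, Tendsto (fun e => e * x) l (𝓝 x) := by
  let _ := CStarAlgebra.spectralOrder I
  have _ := CStarAlgebra.spectralOrderedRing I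
  have h := CStarAlgebra.increasingApproximateUnit I
  exact ⟨_, h.neBot, h.eventually_norm, h.tendsto_mul_right⟩

/-- Approximating `ξ` by a vector where the limit exists, the uniform bound makes `S e ξ` Cauchy
along `l`, and `H` is complete. -/
theorem isClosed_setOf_exists_tendsto {α : Type*} {l : Filter α} [l.NeBot] {S : α → H →L[ℂ] H}
    {C : ℝ} (hS : ∀ᶠ e in l, ‖S e‖ ≤ C) :
    IsClosed {ξ : H | ∃ η, Tendsto (fun e => S e ξ) l (𝓝 η)} := by
  refine isClosed_of_closure_subset fun ξ hξ => ?_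
  change ∃ η, Tendsto (fun e => S e ξ) l (𝓝 η)
  rw [← cauchy_map_iff_exists_tendsto, Metric.cauchy_iff]
  refine ⟨inferInstance, fun ε hε => ?_⟩
  have hC : 0 ≤ C := by
    obtain ⟨e, he⟩ := hS.exists
    exact (norm_nonneg _).trans he
  -- Using `C + 1` rather than `C` keeps the denominator positive when `C = 0`.
  obtain ⟨ζ, ⟨η, hη⟩, hζ⟩ := Metric.mem_closure_iff.mp hξ (ε / (4 * (C + 1))) (by positivity)
  have hev : ∀ᶠ e in l, dist (S e ξ) η < ε / 2 := by
    filter_upwards [hS, hη (Metric.ball_mem_nhds η (by positivity : 0 < ε / 4))] with e he h2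
    have h3 : dist (S e ξ) (S e ζ) ≤ C * dist ξ ζ := by
      rw [dist_eq_norm, dist_eq_norm, ← map_sub]
      exact ((S e).le_opNorm _).trans (mul_le_mul_of_nonneg_right he (norm_nonneg _))
    have h4 : C * dist ξ ζ ≤ ε / 4 := by
      have h5 : (C + 1) * dist ξ ζ ≤ (C + 1) * (ε / (4 * (C + 1))) :=
        mul_le_mul_of_nonneg_left hζ.le (by positivity)
      have h6 : (C + 1) * (ε / (4 * (C + 1))) = ε / 4 := by field_simp
      nlinarith [dist_nonneg (x := ξ) (y := ζ)]
    have h7 : dist (S e ζ) η < ε / 4 := h2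
    linarith [dist_triangle (S e ξ) (S e ζ) η]
  refine ⟨_, Filter.image_mem_map hev, ?_⟩
  rintro _ ⟨e, he, rfl⟩ _ ⟨e', he', rfl⟩
  have h1 : dist (S e ξ) η < ε / 2 := he
  have h2 : dist (S e' ξ) η < ε / 2 := he'
  linarith [dist_triangle_right (S e ξ) (S e' ξ) η]

end Essential

namespace MultiplierAction

variable {I A H : Type*} [NonUnitalCStarAlgebra I] [NonUnitalCStarAlgebra A]
  [NormedAddCommGroup H] [InnerProductSpace ℂ H] [CompleteSpace H] {φ : I →⋆ₙₐ[ℂ] A}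

/-- The operator is the strong limit of `π (T.act a e)` along an approximate unit. On the range of
`π` the limit exists because `T.act a e * x = T.act a (e * x)` tends to `T.act a x`, and on the null
space everything is zero. The bound `‖a‖` carries convergence to all of `H`. -/
theorem exists_operator_extension (T : MultiplierAction φ) (π : I →⋆ₙₐ[ℂ] (H →L[ℂ] H)) (a : A) :
    ∃ S : H →L[ℂ] H, (∀ x h, S (π x h) = π (T.act a x) h) ∧
      ∀ ξ, (∀ x, π x ξ = 0) → S ξ = 0 := by
  obtain ⟨l, _, hl1, hl⟩ := exists_approximateUnit I
  have hcont : Continuous (T.act a) :=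
    AddMonoidHomClass.continuous_of_bound (T.act a) ‖a‖ (T.norm_act_le a)
  have hπ : Continuous π := continuous_starAlgHom (B := H →L[ℂ] H) π
  have hbd : ∀ᶠ e in l, ‖π (T.act a e)‖ ≤ ‖a‖ := by
    filter_upwards [hl1] with e he
    refine (NonUnitalStarAlgHom.norm_apply_le (B := H →L[ℂ] H) π _).trans
      ((T.norm_act_le a e).trans ?_)
    exact mul_le_of_le_one_right (norm_nonneg a) he
  have hrange : ∀ x h, Tendsto (fun e => π (T.act a e) (π x h)) l (𝓝 (π (T.act a x) h)) := by
    intro x h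
    have h1 : ∀ e, π (T.act a e) (π x h) = π (T.act a (e * x)) h := fun e => by
      rw [T.act_mul_right, map_mul]; rfl
    simp only [h1]
    have h2 : Continuous fun y => π (T.act a y) h := by fun_prop
    exact (h2.tendsto x).comp (hl x)
  have hnull : ∀ ξ, (∀ x, π x ξ = 0) → Tendsto (fun e => π (T.act a e) ξ) l (𝓝 0) := by
    intro ξ hξ
    simp only [hξ]
    exact tendsto_const_nhds
  have hex : ∀ ξ, ∃ η, Tendsto (fun e => π (T.act a e) ξ) l (𝓝 η) := by
    refine rep_induction π (isClosed_setOf_exists_tendsto hbd) ?_ ?_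
      (fun x h => ⟨_, hrange x h⟩) (fun ξ hξ => ⟨_, hnull ξ hξ⟩)
    · rintro ξ η ⟨ξ', h⟩ ⟨η', h'⟩
      exact ⟨ξ' + η', by simpa only [map_add] using h.add h'⟩
    · rintro c ξ ⟨ξ', h⟩
      exact ⟨c • ξ', by simpa only [map_smul] using h.const_smul c⟩
  choose S hS using hex
  let S' : H →ₗ[ℂ] H :=
    { toFun := S
      map_add' := fun ξ η => tendsto_nhds_unique (hS _)
        (by simpa only [map_add] using (hS ξ).add (hS η))
      map_smul' := fun c ξ => tendsto_nhds_unique (hS _)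
        (by simpa only [map_smul, RingHom.id_apply] using (hS ξ).const_smul c) }
  refine ⟨S'.mkContinuous ‖a‖ fun ξ => ?_, fun x h => tendsto_nhds_unique (hS _) (hrange x h),
    fun ξ hξ => tendsto_nhds_unique (hS _) (hnull ξ hξ)⟩
  refine le_of_tendsto (hS ξ).norm ?_
  filter_upwards [hbd] with e he
  exact ((π (T.act a e)).le_opNorm ξ).trans (mul_le_mul_of_nonneg_right he (norm_nonneg ξ))

/-- The operators of the previous lemma are determined by their values on the range and null space
of `π`, so the algebraic identities need only be checked there. No nondegeneracy of `π` is required,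
as the extension vanishes on the null space. -/
theorem exists_rep_extension (T : MultiplierAction φ) (π : I →⋆ₙₐ[ℂ] (H →L[ℂ] H)) :
    ∃ σ : A →⋆ₙₐ[ℂ] (H →L[ℂ] H), σ.comp φ = π := by
  choose σ hσ hσ0 using fun a => T.exists_operator_extension π a
  have hext : ∀ S S' : H →L[ℂ] H, (∀ x h, S (π x h) = S' (π x h)) →
      (∀ ξ, (∀ x, π x ξ = 0) → S ξ = S' ξ) → S = S' := fun S S' h h0 =>
    ContinuousLinearMap.ext <| rep_induction π (isClosed_eq S.continuous S'.continuous)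
      (fun ξ η h1 h2 => by rw [map_add, map_add, h1, h2])
      (fun c ξ h1 => by rw [map_smul, map_smul, h1]) h h0
  have hadd : ∀ a b, σ (a + b) = σ a + σ b := fun a b => hext _ _
    (fun x h => by simp [hσ]) (fun ξ hξ => by simp [hσ0 _ ξ hξ])
  have hsmul : ∀ (c : ℂ) a, σ (c • a) = c • σ a := fun c a => hext _ _
    (fun x h => by simp [hσ]) (fun ξ hξ => by simp [hσ0 _ ξ hξ])
  have hmul : ∀ a b, σ (a * b) = σ a * σ b := fun a b => hext _ _
    (fun x h => by simp [hσ, T.act_mul]) (fun ξ hξ => by simp [hσ0 _ ξ hξ])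
  have hstar : ∀ a, σ (star a) = star (σ a) := fun a => by
    refine (ContinuousLinearMap.eq_adjoint_iff _ _).mpr fun ξ η => ?_
    -- The null space is orthogonal to the range, which disposes of the mixed terms when adjointness
    -- is checked.
    have hnull : ∀ ζ, (∀ x, π x ζ = 0) → ∀ y k, inner ℂ ζ (π y k) = 0 := fun ζ hζ y k => by
      have := inner_rep_left π (star y) ζ k
      rw [star_star] at this
      rw [← this, hζ, inner_zero_left]
    have hnull' : ∀ ζ, (∀ x, π x ζ = 0) → ∀ y k, inner ℂ (π y k) ζ = 0 := fun ζ hζ y k => by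
      rw [inner_rep_left, hζ, inner_zero_right]
    refine rep_induction π (P := fun ξ => inner ℂ (σ (star a) ξ) η = inner ℂ ξ (σ a η))
      (isClosed_eq (by fun_prop) (by fun_prop))
      (fun ξ ξ' h1 h2 => by rw [map_add, inner_add_left, inner_add_left, h1, h2])
      (fun c ξ h1 => by rw [map_smul, inner_smul_left, inner_smul_left, h1]) ?_ ?_ ξ
    · intro x h
      refine rep_induction π (P := fun η => inner ℂ (σ (star a) (π x h)) η =
          inner ℂ (π x h) (σ a η))
        (isClosed_eq (by fun_prop) (by fun_prop))
        (fun ξ ξ' h1 h2 => by rw [map_add, inner_add_right, inner_add_right, h1, h2])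
        (fun c ξ h1 => by rw [map_smul, inner_smul_right, inner_smul_right, h1]) ?_ ?_ η
      · intro y k
        rw [hσ, hσ, inner_rep_left, inner_rep_left, ← mul_apply_eq_comp, ← map_mul,
          ← mul_apply_eq_comp, ← map_mul, T.star_act_mul, star_star]
      · intro ζ hζ
        rw [hσ, hσ0 a ζ hζ, hnull' ζ hζ, inner_zero_right]
    · intro ζ hζ
      rw [hσ0 _ ζ hζ, inner_zero_left]
      refine (rep_induction π (P := fun η => inner ℂ ζ (σ a η) = 0)
        (isClosed_eq (by fun_prop) (by fun_prop))
        (fun ξ ξ' h1 h2 => by rw [map_add, inner_add_right, h1, h2, add_zero])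
        (fun c ξ h1 => by rw [map_smul, inner_smul_right, h1, mul_zero]) ?_ ?_ η).symm
      · intro y k
        rw [hσ, hnull ζ hζ]
      · intro ω hω
        rw [hσ0 _ ω hω, inner_zero_right]
  refine ⟨{ toFun := σ
            map_smul' := hsmul
            map_zero' := by simpa using hsmul 0 0
            map_add' := hadd
            map_mul' := hmul
            map_star' := hstar }, NonUnitalStarAlgHom.ext fun x => ?_⟩
  change σ (φ x) = π x
  refine hext _ _ (fun y h => ?_) fun ξ hξ => ?_
  · rw [hσ, T.act_apply, map_mul]; rfl
  · rw [hσ0 _ ξ hξ, hξ]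

end MultiplierAction

end Representation

universe u v

/-! ### Isometry of the canonical maps. -/

section Injective

variable {I A : Type u} {J B : Type v} [NonUnitalCStarAlgebra I] [NonUnitalCStarAlgebra J]
  [NonUnitalCStarAlgebra A] [NonUnitalCStarAlgebra B] {φ : I →⋆ₙₐ[ℂ] A} {ψ : J →⋆ₙₐ[ℂ] B}

/-- For the nontrivial inequality, each seminorm in the supremum for `I ⊗ J` is the restriction of
one in the supremum for `A ⊗ B`. In the minimal case the extended representations act on the same
Hilbert spaces, so no universe changes. -/
theorem norm_algMap (T : MultiplierAction φ) (U : MultiplierAction ψ) (α : CStarTensor.Kind)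
    (t : I ⊗[ℂ] J) :
    CStarTensor.norm A B α (CStarTensor.algMap φ ψ t) = CStarTensor.norm I J α t := by
  refine le_antisymm (CStarTensor.norm_algMap_le α φ ψ t) ?_
  cases α with
  | max =>
    refine CStarSeminorm.sup_le (CStarSeminorm.nonneg _ _) fun p _ => ?_
    obtain ⟨q, hq⟩ := T.exists_seminorm_extension U p
    rw [← hq]
    exact CStarSeminorm.le_sup (Set.mem_univ q) _
  | min =>
    refine CStarSeminorm.sup_le (CStarSeminorm.nonneg _ _) ?_
    rintro _ ⟨H, _, _, _, K, _, _, _, π, ρ, rfl⟩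
    obtain ⟨σ, rfl⟩ := T.exists_rep_extension π
    obtain ⟨τ, rfl⟩ := U.exists_rep_extension ρ
    rw [CStarTensor.spatialSeminorm_apply, ← CStarTensor.rep_algMap,
      ← CStarTensor.spatialSeminorm_apply]
    exact CStarSeminorm.le_sup (S := CStarTensor.spatialSeminorms A B)
      ⟨H, _, _, inferInstance, K, _, _, inferInstance, σ, τ, rfl⟩ _

theorem norm_map (T : MultiplierAction φ) (U : MultiplierAction ψ) (α : CStarTensor.Kind)
    (t : CStarTensorProduct α I J) : ‖CStarTensor.map α φ ψ t‖ = ‖t‖ := by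
  have hc : Continuous (CStarTensor.map α φ ψ) := continuous_starAlgHom _
  refine CStarSeminorm.completed_induction t (isClosed_eq (by fun_prop) (by fun_prop)) fun t => ?_
  change ‖CStarTensor.map α φ ψ (CStarSeminorm.toCompleted _ t)‖ =
    ‖CStarSeminorm.toCompleted _ t‖
  rw [CStarTensor.map, CStarSeminorm.mapCompleted_toCompleted, CStarSeminorm.norm_toCompleted,
    CStarSeminorm.norm_toCompleted, norm_algMap T U]

theorem map_injective (T : MultiplierAction φ) (U : MultiplierAction ψ) (α : CStarTensor.Kind) :
    Function.Injective (CStarTensor.map α φ ψ) := by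
  rw [injective_iff_map_eq_zero]
  intro t ht
  rw [← norm_eq_zero, ← norm_map T U, ht, norm_zero]

end Injective

/-! ### The action of a graded algebra on a component. -/

section Action

variable {L : Type*} [SemilatticeInf L] {A : Type*} [NonUnitalCStarAlgebra A] {I : L → Type*}
  [∀ l, NonUnitalCStarAlgebra (I l)] {φ : ∀ l, I l →⋆ₙₐ[ℂ] A}

/-- The action of a graded C*-algebra on one of its components by multipliers, through the
projection onto the components of larger index. -/
def componentAction (hφ : IsCStarGrading fun l => NonUnitalStarAlgHom.range (φ l)) (l : L)
    (hinj : Function.Injective (φ l)) : MultiplierAction (φ l) :=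
  have hex : ∀ a x, ∃ z, φ l z = projection hφ l a * φ l x := fun a x =>
    projection_mul_mem hφ l a (NonUnitalStarAlgHom.mem_range_self (φ l) x)
  -- The preimage is unique since `φ l` is injective, so every identity for `f` can be checked in
  -- `A`.
  let f : A → I l → I l := fun a x => (hex a x).choose
  have hf : ∀ a x, φ l (f a x) = projection hφ l a * φ l x := fun a x => (hex a x).choose_spec
  { act := LinearMap.mk₂ ℂ f
      (fun a b x => hinj (by simp only [map_add, hf, add_mul]))
      (fun c a x => hinj (by simp only [map_smul, hf, smul_mul_assoc]))
      (fun a x y => hinj (by simp only [map_add, hf, mul_add]))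
      (fun c a x => hinj (by simp only [map_smul, hf, mul_smul_comm]))
    act_mul := fun a b x => hinj (by simp only [LinearMap.mk₂_apply, hf, map_mul, mul_assoc])
    star_act_mul := fun a x y => hinj (by
      simp only [LinearMap.mk₂_apply, map_mul, map_star, hf, star_mul, mul_assoc])
    act_apply := fun x y => hinj (by
      simp only [LinearMap.mk₂_apply, hf, map_mul]
      rw [projection_of_le hφ le_rfl (NonUnitalStarAlgHom.mem_range_self (φ l) x)]) }

end Action

/-! ### The grading of the tensor product. -/

section Grading

variable {L M : Type*} [SemilatticeInf L] [SemilatticeInf M] {A : Type u} {B : Type v}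
  [NonUnitalCStarAlgebra A] [NonUnitalCStarAlgebra B] {I : L → Type u} {J : M → Type v}
  [∀ l, NonUnitalCStarAlgebra (I l)] [∀ m, NonUnitalCStarAlgebra (J m)]
  {φ : ∀ l, I l →⋆ₙₐ[ℂ] A} {ψ : ∀ m, J m →⋆ₙₐ[ℂ] B}

theorem map_toCompleted {I : Type u} {J : Type v} [NonUnitalCStarAlgebra I]
    [NonUnitalCStarAlgebra J] (φ : I →⋆ₙₐ[ℂ] A) (ψ : J →⋆ₙₐ[ℂ] B) (α : CStarTensor.Kind)
    (t : I ⊗[ℂ] J) :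
    CStarTensor.map α φ ψ ((CStarTensor.norm I J α).toCompleted t) =
      (CStarTensor.norm A B α).toCompleted (CStarTensor.algMap φ ψ t) :=
  CStarSeminorm.mapCompleted_toCompleted _ _ _ _ _

theorem map_injective_of_grading (hφi : ∀ l, Function.Injective (φ l))
    (hφ : IsCStarGrading fun l => NonUnitalStarAlgHom.range (φ l))
    (hψi : ∀ m, Function.Injective (ψ m))
    (hψ : IsCStarGrading fun m => NonUnitalStarAlgHom.range (ψ m)) (α : CStarTensor.Kind)
    (l : L) (m : M) : Function.Injective (CStarTensor.map α (φ l) (ψ m)) :=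
  map_injective (componentAction hφ l (hφi l)) (componentAction hψ m (hψi m)) α

theorem map_projection_of_le (hφ : IsCStarGrading fun l => NonUnitalStarAlgHom.range (φ l))
    (hψ : IsCStarGrading fun m => NonUnitalStarAlgHom.range (ψ m)) (α : CStarTensor.Kind)
    {q r : L × M} (h : q ≤ r) (t : CStarTensorProduct α (I r.1) (J r.2)) :
    CStarTensor.map α (projection hφ q.1) (projection hψ q.2)
      (CStarTensor.map α (φ r.1) (ψ r.2) t) = CStarTensor.map α (φ r.1) (ψ r.2) t := by
  have hc := continuous_starAlgHom (CStarTensor.map α (projection hφ q.1) (projection hψ q.2))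
  have hc' := continuous_starAlgHom (CStarTensor.map α (φ r.1) (ψ r.2))
  refine CStarSeminorm.completed_induction t (isClosed_eq (hc.comp hc') hc') fun t => ?_
  induction t with
  | zero => simp only [map_zero]
  | add x y hx hy => simp only [map_add, hx, hy]
  | tmul x y =>
    change CStarTensor.map α (projection hφ q.1) (projection hψ q.2)
      (CStarTensor.map α (φ r.1) (ψ r.2) (CStarTensor.tmul α x y)) =
        CStarTensor.map α (φ r.1) (ψ r.2) (CStarTensor.tmul α x y)
    rw [CStarTensor.map_tmul, CStarTensor.map_tmul,
      projection_of_le hφ h.1 (NonUnitalStarAlgHom.mem_range_self (φ r.1) x),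
      projection_of_le hψ h.2 (NonUnitalStarAlgHom.mem_range_self (ψ r.2) y)]

/-- If `q ≤ r` fails, it fails in one coordinate, and the corresponding factor of every elementary
tensor is killed. With the previous lemma, the tensor product of the truncations is a truncation for
the product order. -/
theorem map_projection_of_not_le (hφ : IsCStarGrading fun l => NonUnitalStarAlgHom.range (φ l))
    (hψ : IsCStarGrading fun m => NonUnitalStarAlgHom.range (ψ m)) (α : CStarTensor.Kind)
    {q r : L × M} (h : ¬ q ≤ r) (t : CStarTensorProduct α (I r.1) (J r.2)) :
    CStarTensor.map α (projection hφ q.1) (projection hψ q.2)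
      (CStarTensor.map α (φ r.1) (ψ r.2) t) = 0 := by
  have hc := continuous_starAlgHom (CStarTensor.map α (projection hφ q.1) (projection hψ q.2))
  have hc' := continuous_starAlgHom (CStarTensor.map α (φ r.1) (ψ r.2))
  refine CStarSeminorm.completed_induction t
    (isClosed_eq (hc.comp hc') continuous_const) fun t => ?_
  induction t with
  | zero => simp only [map_zero]
  | add x y hx hy => simp only [map_add, hx, hy, add_zero]
  | tmul x y =>
    change CStarTensor.map α (projection hφ q.1) (projection hψ q.2)
      (CStarTensor.map α (φ r.1) (ψ r.2) (CStarTensor.tmul α x y)) = 0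
    rw [CStarTensor.map_tmul, CStarTensor.map_tmul, CStarTensor.tmul]
    rw [Prod.le_def, not_and_or] at h
    rcases h with h | h
    · rw [projection_of_not_le hφ h (NonUnitalStarAlgHom.mem_range_self (φ r.1) x),
        TensorProduct.zero_tmul, map_zero]
    · rw [projection_of_not_le hψ h (NonUnitalStarAlgHom.mem_range_self (ψ r.2) y),
        TensorProduct.tmul_zero, map_zero]

/-- Algebraic tensors suffice here: the ranges turn out to be closed, so the product rule extends to
the completions by continuity. -/
theorem map_mul_map_mem (hφ : IsCStarGrading fun l => NonUnitalStarAlgHom.range (φ l))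
    (hψ : IsCStarGrading fun m => NonUnitalStarAlgHom.range (ψ m)) (α : CStarTensor.Kind)
    (q r : L × M) (t : I q.1 ⊗[ℂ] J q.2) (s : I r.1 ⊗[ℂ] J r.2) :
    CStarTensor.map α (φ q.1) (ψ q.2) ((CStarTensor.norm _ _ α).toCompleted t) *
      CStarTensor.map α (φ r.1) (ψ r.2) ((CStarTensor.norm _ _ α).toCompleted s) ∈
        NonUnitalStarAlgHom.range (CStarTensor.map α (φ (q ⊓ r).1) (ψ (q ⊓ r).2)) := by
  induction t with
  | zero => simp only [map_zero, zero_mul]; exact zero_mem _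
  | add t t' h h' => simp only [map_add, add_mul]; exact add_mem h h'
  | tmul x y =>
    induction s with
    | zero => simp only [map_zero, mul_zero]; exact zero_mem _
    | add t t' h h' => simp only [map_add, mul_add]; exact add_mem h h'
    | tmul x' y' =>
      obtain ⟨z, hz⟩ := hφ.mul_mem q.1 r.1 _ (NonUnitalStarAlgHom.mem_range_self (φ q.1) x) _
        (NonUnitalStarAlgHom.mem_range_self (φ r.1) x')
      obtain ⟨w, hw⟩ := hψ.mul_mem q.2 r.2 _ (NonUnitalStarAlgHom.mem_range_self (ψ q.2) y) _
        (NonUnitalStarAlgHom.mem_range_self (ψ r.2) y')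
      refine ⟨CStarTensor.tmul α z w, ?_⟩
      change CStarTensor.map α (φ (q ⊓ r).1) (ψ (q ⊓ r).2) (CStarTensor.tmul α z w) = _
      rw [map_toCompleted, map_toCompleted, ← map_mul, CStarTensor.algMap_tmul,
        CStarTensor.algMap_tmul, Algebra.TensorProduct.tmul_mul_tmul, CStarTensor.map_tmul,
        CStarTensor.tmul]
      congr 2

/-- The bound `‖a ⊗ b‖ ≤ ‖a‖‖b‖` makes the elementary tensor separately continuous, so the two
totality hypotheses can be used one variable at a time. -/
theorem dense_span_map (hφ : IsCStarGrading fun l => NonUnitalStarAlgHom.range (φ l))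
    (hψ : IsCStarGrading fun m => NonUnitalStarAlgHom.range (ψ m)) (α : CStarTensor.Kind) :
    Dense (Submodule.span ℂ (⋃ q : L × M, (NonUnitalStarAlgHom.range
      (CStarTensor.map α (φ q.1) (ψ q.2)) : Set (CStarTensorProduct α A B))) :
        Set (CStarTensorProduct α A B)) := by
  set W := Submodule.span ℂ (⋃ q : L × M, (NonUnitalStarAlgHom.range
      (CStarTensor.map α (φ q.1) (ψ q.2)) : Set (CStarTensorProduct α A B)))
  have hnorm : ∀ a b, ‖CStarTensor.tmul α a b‖ ≤ ‖a‖ * ‖b‖ := fun (a : A) (b : B) => by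
    rw [CStarTensor.tmul, CStarSeminorm.norm_toCompleted]
    exact CStarSeminorm.tmul_le _ a b
  let β : A →ₗ[ℂ] B →ₗ[ℂ] CStarTensorProduct α A B :=
    (TensorProduct.mk ℂ A B).compr₂ (CStarTensor.norm A B α).mkₗ
  have hβ : ∀ a b, β a b = CStarTensor.tmul α a b := fun _ _ => rfl
  have hc1 : ∀ b, Continuous fun a => β a b := fun b =>
    AddMonoidHomClass.continuous_of_bound (β.flip b) ‖b‖ fun a => by
      rw [mul_comm]; exact hnorm a b
  have hc2 : ∀ a, Continuous (β a) := fun a =>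
    AddMonoidHomClass.continuous_of_bound (β a) ‖a‖ fun b => hnorm a b
  have hcl : IsClosed (W.topologicalClosure : Set (CStarTensorProduct α A B)) :=
    W.isClosed_topologicalClosure
  have hgen : ∀ a ∈ Submodule.span ℂ (⋃ l, (NonUnitalStarAlgHom.range (φ l) : Set A)),
      ∀ b ∈ Submodule.span ℂ (⋃ m, (NonUnitalStarAlgHom.range (ψ m) : Set B)),
        β a b ∈ W := by
    intro a ha b hb
    induction ha, hb using Submodule.span_induction₂ with
    | mem_mem x y hx hy =>
      obtain ⟨l, x, rfl⟩ := Set.mem_iUnion.mp hx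
      obtain ⟨m, y, rfl⟩ := Set.mem_iUnion.mp hy
      refine Submodule.subset_span (Set.mem_iUnion.mpr ⟨(l, m), CStarTensor.tmul α x y, ?_⟩)
      exact CStarTensor.map_tmul α (φ l) (ψ m) x y
    | zero_left y hy => simp
    | zero_right x hx => simp
    | add_left x y z hx hy hz h1 h2 =>
      rw [map_add, LinearMap.add_apply]; exact add_mem h1 h2
    | add_right x y z hx hy hz h1 h2 => rw [map_add]; exact add_mem h1 h2
    | smul_left r x y hx hy h =>
      rw [map_smul, LinearMap.smul_apply]; exact Submodule.smul_mem _ _ h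
    | smul_right r x y hx hy h => rw [map_smul]; exact Submodule.smul_mem _ _ h
  have hall : ∀ a b, β a b ∈ W.topologicalClosure := by
    intro a b
    refine closure_minimal (fun b' hb' => ?_) (hcl.preimage (hc2 a)) (hψ.total b)
    refine closure_minimal (fun a' ha' => ?_) (hcl.preimage (hc1 b')) (hφ.total a)
    exact W.le_topologicalClosure (hgen a' ha' b' hb')
  intro t
  change t ∈ W.topologicalClosure
  refine CStarSeminorm.completed_induction t hcl fun t => ?_
  induction t with
  | zero => rw [map_zero]; exact zero_mem _
  | add x y hx hy => rw [map_add]; exact add_mem hx hy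
  | tmul a b => exact hall a b

/-- The tensor product of two graded C*-algebras is graded by the tensor products of the
components. -/
theorem isCStarGrading_tensor (hφi : ∀ l, Function.Injective (φ l))
    (hφ : IsCStarGrading fun l => NonUnitalStarAlgHom.range (φ l))
    (hψi : ∀ m, Function.Injective (ψ m))
    (hψ : IsCStarGrading fun m => NonUnitalStarAlgHom.range (ψ m)) (α : CStarTensor.Kind) :
    IsCStarGrading fun q : L × M =>
      NonUnitalStarAlgHom.range (CStarTensor.map α (φ q.1) (ψ q.2)) := by
  have hclosed : ∀ q : L × M, IsClosed (NonUnitalStarAlgHom.range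
      (CStarTensor.map α (φ q.1) (ψ q.2)) : Set (CStarTensorProduct α A B)) := fun q =>
    (NonUnitalStarAlgHom.isometry _
      (map_injective_of_grading hφi hφ hψi hψ α q.1 q.2)).isClosedEmbedding.isClosed_range
  refine ⟨hclosed, ?_, dense_span_map hφ hψ α, ?_⟩
  · classical
    intro s x hx hsum
    by_contra hne
    push Not at hne
    obtain ⟨i, hi, hxi⟩ := hne
    -- Truncating the vanishing sum at a maximal `q` of the support leaves only `x q`: other indices
    -- above `q` carry zero terms, and those not above `q` are killed.
    obtain ⟨q, hq, hmax⟩ := Finset.exists_maximal (s := s.filter fun q => x q ≠ 0)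
      ⟨i, Finset.mem_filter.mpr ⟨hi, hxi⟩⟩
    obtain ⟨hqs, hxq⟩ := Finset.mem_filter.mp hq
    apply hxq
    have h := congrArg (CStarTensor.map α (projection hφ q.1) (projection hψ q.2)) hsum
    rw [map_zero, map_sum, Finset.sum_eq_single_of_mem q hqs] at h
    · obtain ⟨t, ht⟩ := hx q hqs
      rw [← h, ← ht]
      exact (map_projection_of_le hφ hψ α le_rfl t).symm
    · intro r hr hrq
      obtain ⟨t, ht⟩ := hx r hr
      by_cases hle : q ≤ r
      · by_cases h0 : x r = 0
        · rw [h0, map_zero]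
        · exact absurd (le_antisymm (hmax (Finset.mem_filter.mpr ⟨hr, h0⟩) hle) hle) hrq
      · rw [← ht]
        exact map_projection_of_not_le hφ hψ α hle t
  · rintro q r _ ⟨t, rfl⟩ _ ⟨s, rfl⟩
    have hc := continuous_starAlgHom (CStarTensor.map α (φ q.1) (ψ q.2))
    have hc' := continuous_starAlgHom (CStarTensor.map α (φ r.1) (ψ r.2))
    refine CStarSeminorm.completed_induction t
      ((hclosed (q ⊓ r)).preimage (hc.mul continuous_const)) fun t => ?_
    refine CStarSeminorm.completed_induction s
      ((hclosed (q ⊓ r)).preimage (continuous_const.mul hc')) fun s => ?_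
    exact map_mul_map_mem hφ hψ α q r t s

theorem isCStarGrading_comp_orderIso {𝒜 : L → NonUnitalStarSubalgebra ℂ A}
    (h : IsCStarGrading 𝒜) (e : M ≃o L) : IsCStarGrading fun m => 𝒜 (e m) where
  isClosed m := h.isClosed (e m)
  linearIndependent s x hx h0 m hm := by
    have := h.linearIndependent (s.map e.toEquiv.toEmbedding) (fun l => x (e.symm l))
      (fun l hl => by
        obtain ⟨m, hm, rfl⟩ := Finset.mem_map.mp hl
        simpa using hx m hm)
      (by simpa using h0) (e m) (Finset.mem_map_of_mem _ hm)
    simpa using this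
  total := by
    have := h.total
    rwa [← e.surjective.iUnion_comp] at this
  mul_mem i j a ha b hb := by
    rw [map_inf]
    exact h.mul_mem _ _ a ha b hb

/-- An ungraded algebra is graded by a point; this feeds `C` into the two-sided result. -/
theorem isCStarGrading_id (C : Type*) [NonUnitalCStarAlgebra C] :
    IsCStarGrading fun _ : Unit => NonUnitalStarAlgHom.range (NonUnitalStarAlgHom.id ℂ C) := by
  have h : ((NonUnitalStarAlgHom.range (NonUnitalStarAlgHom.id ℂ C) :
      NonUnitalStarSubalgebra ℂ C) : Set C) = Set.univ :=
    Set.eq_univ_of_forall fun x => ⟨x, rfl⟩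
  refine ⟨fun _ => by rw [h]; exact isClosed_univ, fun s x _ h0 i hi => ?_, ?_, ?_⟩
  · rwa [Finset.sum_eq_single_of_mem i hi fun j _ hj => absurd (Subsingleton.elim j i) hj] at h0
  · rw [h, Set.iUnion_const, Submodule.span_univ]
    exact dense_univ
  · intro _ _ a _ b _
    exact ⟨a * b, rfl⟩

/-- A semilattice is isomorphic to its product with a point. -/
def orderIsoProdUnit (L : Type*) [SemilatticeInf L] : L ≃o L × Unit where
  toFun l := (l, ())
  invFun q := q.1
  left_inv _ := rfl
  right_inv _ := rfl
  map_rel_iff' := by simp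

end Grading

theorem range_subtype {A : Type*} [NonUnitalCStarAlgebra A] (S : NonUnitalStarSubalgebra ℂ A) :
    NonUnitalStarAlgHom.range (NonUnitalStarSubalgebraClass.subtype S) = S := by
  ext x
  exact ⟨fun ⟨y, hy⟩ => hy ▸ y.2, fun hx => ⟨⟨x, hx⟩, rfl⟩⟩

end CStarGraded

end

theorem proposition4p1p2 {L M A B C : Type*} [SemilatticeInf L] [SemilatticeInf M]
    [NonUnitalCStarAlgebra A] [NonUnitalCStarAlgebra B] [NonUnitalCStarAlgebra C]
    (α : CStarTensor.Kind)
    (𝒜 : L → NonUnitalStarSubalgebra ℂ A) [∀ l, IsClosed (𝒜 l : Set A)] (h𝒜 : IsCStarGrading 𝒜)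
    (ℬ : M → NonUnitalStarSubalgebra ℂ B) [∀ m, IsClosed (ℬ m : Set B)] (hℬ : IsCStarGrading ℬ) :
    ((∀ l m, Function.Injective (CStarTensor.map α (NonUnitalStarSubalgebraClass.subtype (𝒜 l))
          (NonUnitalStarSubalgebraClass.subtype (ℬ m)))) ∧
      IsCStarGrading fun q : L × M => NonUnitalStarAlgHom.range
        (CStarTensor.map α (NonUnitalStarSubalgebraClass.subtype (𝒜 q.1))
          (NonUnitalStarSubalgebraClass.subtype (ℬ q.2)))) ∧
    ((∀ l, Function.Injective (CStarTensor.map α (NonUnitalStarSubalgebraClass.subtype (𝒜 l))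
          (NonUnitalStarAlgHom.id ℂ C))) ∧
      IsCStarGrading fun l : L => NonUnitalStarAlgHom.range
        (CStarTensor.map α (NonUnitalStarSubalgebraClass.subtype (𝒜 l))
          (NonUnitalStarAlgHom.id ℂ C))) := by
  have hA : IsCStarGrading fun l =>
      NonUnitalStarAlgHom.range (NonUnitalStarSubalgebraClass.subtype (𝒜 l)) := by
    simpa only [CStarGraded.range_subtype] using h𝒜
  have hB : IsCStarGrading fun m =>
      NonUnitalStarAlgHom.range (NonUnitalStarSubalgebraClass.subtype (ℬ m)) := by
    simpa only [CStarGraded.range_subtype] using hℬ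
  have hAi : ∀ l, Function.Injective (NonUnitalStarSubalgebraClass.subtype (𝒜 l)) :=
    fun _ => Subtype.val_injective
  have hBi : ∀ m, Function.Injective (NonUnitalStarSubalgebraClass.subtype (ℬ m)) :=
    fun _ => Subtype.val_injective
  have hC := CStarGraded.isCStarGrading_id C
  have hCi : ∀ _ : Unit, Function.Injective (NonUnitalStarAlgHom.id ℂ C) :=
    fun _ => Function.injective_id
  refine ⟨⟨CStarGraded.map_injective_of_grading hAi hA hBi hB α,
      CStarGraded.isCStarGrading_tensor hAi hA hBi hB α⟩,
    fun l => CStarGraded.map_injective_of_grading hAi hA hCi hC α l (), ?_⟩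
  -- The grading obtained for `C` is indexed by `L × Unit` and is transported back to `L`.
  exact CStarGraded.isCStarGrading_comp_orderIso
    (CStarGraded.isCStarGrading_tensor hAi hA hCi hC α) (CStarGraded.orderIsoProdUnit L)
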